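/- Let $\mathbb{K}$ be a field, $A$ a $\mathbb{K}$-algebra, $\Omega^1$ an $A$-bimodule and $d:A\to\Omega^1$ a first order differential calculus, i.e. $d$ is $\mathbb{K}$-linear and $d(ab)=(da)b+a\,db$. Assume that the calculus is surjective, i.e. $\Omega^1$ is spanned by the elements $a\,db$. Then $\Omega^1=\Omega^1_{\mathrm{uni}}/\mathcal{N}$, where $\Omega^1_{\mathrm{uni}}=\ker(A\otimes_{\mathbb{K}}A\to A)$, $d_{\mathrm{uni}}a=a\otimes 1-1\otimes a$, and $\mathcal{N}$ is the kernel of the bimodule map $\Omega^1_{\mathrm{uni}}\to\Omega^1$, $d_{\mathrm{uni}}a\mapsto da$. Let $\mathfrak{X}^1$ be a left dual of $\Omega^1$ in the category of $A$-bimodules, with evaluation $\mathrm{ev}:\mathfrak{X}^1\otimes_A\Omega^1\to A$ and coevaluation $\mathrm{coev}(1)=\sum_i\omega_i\otimes x_i\in\Omega^1\otimes_A\mathfrak{X}^1$, and let $\mathfrak{Y}^1$ be a right dual, with evaluation $\underline{\mathrm{ev}}:\Omega^1\otimes_A\mathfrak{Y}^1\to A$ and coevaluation $\underline{\mathrm{coev}}(1)=\sum_j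 y_j\otimes\rho_j\in\mathfrak{Y}^1\otimes_A\Omega^1$. Write $A^e=A\otimes_{\mathbb K}A^{\mathrm{op}}$, $a\overline{b}=a\otimes b\in A^e$, $\star$ for the free product of $\mathbb{K}$-algebras, $T_{\mathbb{K}}$ for the tensor algebra, $\bullet$ for the product of the algebras below and $[f,g]=f\bullet g-g\bullet f$. Denote by $(x,\omega)$ and $(\omega,y)$ the generators $x\otimes\omega\in\mathfrak{X}^1\otimes_{\mathbb{K}}\Omega^1$ and $\omega\otimes y\in\Omega^1\otimes_{\mathbb{K}}\mathfrak{Y}^1$, and by $\overline{y}$ the generator given by $y\in\mathfrak{Y}^1$ in $T_{\mathbb{K}}\mathfrak{Y}^1$. In the relations below, $a,a',b,b'\in A$, $x\in\mathfrak{X}^1$, $y\in\mathfrak{Y}^1$ and $\omega\in\Omega^1$ are arbitrary. * $B\mathfrak{X}^1$ is the quotient of $A^e\star T_{\mathbb{K}}\mathfrak{X}^1\star T_{\mathbb{K}}(\mathfrak{X}^1\otimes_{\mathbb{K}}\Omega^1)$ by the relations $a\bullet x=ax$, $\;x\bullet a=xa+\mathrm{ev}(x\otimes da)$, $\;x\bullet\overline{a}=\overline{a}\bullet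 x+(x,da)$, $\;a\overline{a'}\bullet(x,\omega)\bullet b\overline{b'}=(axb,b'\omega a')$. * $IB\mathfrak{X}^1$ is the quotient of $A^e\star T_{\mathbb{K}}\mathfrak{X}^1\star T_{\mathbb{K}}(\mathfrak{X}^1\otimes_{\mathbb{K}}\Omega^1)\star T_{\mathbb{K}}(\Omega^1\otimes_{\mathbb{K}}\mathfrak{Y}^1)$ by these relations and $a\overline{a'}\bullet(\omega,y)\bullet b\overline{b'}=(a\omega b,b'ya')$, $\;\sum_i(\omega_i,y)\bullet(x_i,\omega)=\overline{\underline{\mathrm{ev}}(\omega\otimes y)}$, $\;\sum_j(x,\rho_j)\bullet(\omega,y_j)=\mathrm{ev}(x\otimes\omega)$. * $T\mathfrak{X}^1_\bullet$ is the quotient of $A\star T_{\mathbb{K}}\mathfrak{X}^1$ by $a\bullet x=ax$ and $x\bullet a=xa+\mathrm{ev}(x\otimes da)$, and $B$ is the quotient of $A^{\mathrm{op}}\star T\mathfrak{X}^1_\bullet$ by $a\bullet\overline{b}=\overline{b}\bullet a$ and $\sum_m\overline{s_m}\bullet x\bullet\overline{r_m}=0$ for $\sum_m r_m\otimes s_m\in\mathcal{N}$.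 Then: 1. There are $b_i\in A$, $x_i'\in\mathfrak{X}^1$ with $\mathrm{coev}(1)=\sum_i db_i\otimes x'_i$, and $y'_j\in\mathfrak{Y}^1$, $c_j\in A$ with $\underline{\mathrm{coev}}(1)=\sum_j y'_j\otimes dc_j$. 2. $B\mathfrak{X}^1\cong B$ as algebras, by an isomorphism which fixes the generators from $A^e$ and $\mathfrak{X}^1$ and sends $(x,a\,db)$ to $[x,\overline{b}]\bullet\overline{a}$. 3. For every choice as in 1, $IB\mathfrak{X}^1$ is isomorphic as an algebra to the quotient of $B\star T_{\mathbb{K}}\mathfrak{Y}^1$ by the relations $$\overline{a}\bullet\overline{y}=\overline{ya},\qquad \overline{y}\bullet\overline{a}=\overline{ay}+\overline{\underline{\mathrm{ev}}(da\otimes y)},\qquad \sum_m r_m\bullet\overline{y}\bullet s_m=0\ \text{ for } \sum_m r_m\otimes s_m\in\mathcal{N},$$ $$\sum_i[\overline{y},b_i]\bullet x'_i=\overline{y},\qquad \sum_j[x,\overline{c_j}]\bullet\overline{y'_j}=x.$$ The isomorphism can be chosen to fix the generators from $A^e$ and $\mathfrak{X}^1$ and to send $(x,a\,db)$ to $[x,\overline{b}]\bullet\overline{a}$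 and $(a\,db,y)$ to $a\bullet[\overline{y},b]$, its inverse sending $\overline{y}$ to $\sum_i(db_i,y)\bullet x'_i$. Hence the generators from $\mathfrak{X}^1\otimes\Omega^1$ and $\Omega^1\otimes\mathfrak{Y}^1$ are eliminated. -/

import Mathlib

open scoped TensorProduct
open MulOpposite (op)

namespace SurjCalc

universe u v w

noncomputable section

/-! ### Free products of two algebras

The free product (coproduct) of two `K`-algebras, as the two-element case of
`LinearAlgebra.FreeProduct`. -/

/-- The family of two algebras `R`, `S`, lifted to a common universe. -/
def Pair (R : Type u) (S : Type v) : Bool → Type (max u v)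
  | false => ULift.{v} R
  | true => ULift.{u} S

instance Pair.instSemiring (R : Type u) (S : Type v) [Semiring R] [Semiring S] :
    (i : Bool) → Semiring (Pair R S i)
  | false => inferInstanceAs (Semiring (ULift.{v} R))
  | true => inferInstanceAs (Semiring (ULift.{u} S))

instance Pair.instAlgebra (K : Type w) (R : Type u) (S : Type v) [CommSemiring K]
    [Semiring R] [Semiring S] [Algebra K R] [Algebra K S] :
    (i : Bool) → Algebra K (Pair R S i)
  | false => inferInstanceAs (Algebra K (ULift.{v} R))
  | true => inferInstanceAs (Algebra K (ULift.{u} S))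

/-- The free product `R ⋆ S` of `K`-algebras. -/
abbrev Coprod (K : Type w) (R : Type u) (S : Type v) [CommRing K]
    [Semiring R] [Semiring S] [Algebra K R] [Algebra K S] : Type (max u v w) :=
  LinearAlgebra.FreeProduct K (Pair R S)

namespace Coprod

/-- The canonical map `R → R ⋆ S`. -/
def inl (K : Type w) (R : Type u) (S : Type v) [CommRing K]
    [Semiring R] [Semiring S] [Algebra K R] [Algebra K S] : R →ₐ[K] Coprod K R S :=
  (LinearAlgebra.FreeProduct.ι K (Pair R S) false).comp
    (ULift.algEquiv (R := K) (A := R)).symm.toAlgHom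

/-- The canonical map `S → R ⋆ S`. -/
def inr (K : Type w) (R : Type u) (S : Type v) [CommRing K]
    [Semiring R] [Semiring S] [Algebra K R] [Algebra K S] : S →ₐ[K] Coprod K R S :=
  (LinearAlgebra.FreeProduct.ι K (Pair R S) true).comp
    (ULift.algEquiv (R := K) (A := S)).symm.toAlgHom

end Coprod

/-! ### Calculi and dual bimodules

An `A`-bimodule is a `K`-space `M` with commuting `K`-linear actions of `A` and `Aᵐᵒᵖ`; the right
action of `a` on `m` is written `op a • m`. -/

/-- A first order differential calculus `d : A → Ω` on the `K`-algebra `A`. -/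
structure Calculus (K A Ω : Type*) [Field K] [Ring A] [Algebra K A] [AddCommGroup Ω]
    [Module K Ω] [Module A Ω] [Module Aᵐᵒᵖ Ω] where
  d : A →ₗ[K] Ω
  leibniz : ∀ a b : A, d (a * b) = a • d b + op b • d a

namespace Calculus

variable {K A Ω : Type*} [Field K] [Ring A] [Algebra K A] [AddCommGroup Ω]
  [Module K Ω] [Module A Ω] [Module Aᵐᵒᵖ Ω]

/-- The calculus is surjective: `Ω` is spanned by the elements `a db`. -/
def IsSurjective (D : Calculus K A Ω) : Prop :=
  Submodule.span K {ξ : Ω | ∃ a b : A, ξ = a • D.d b} = ⊤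

/-- The universal forms `Ω_uni = ker (A ⊗ A → A)`, with differential
`d_uni a = a ⊗ 1 - 1 ⊗ a`. -/
def universalForms (K A : Type*) [Field K] [Ring A] [Algebra K A] : Submodule K (A ⊗[K] A) :=
  LinearMap.ker (LinearMap.mul' K A)

/-- The linear map `∑ r ⊗ s ↦ ∑ (dr) s`. Its restriction to `Ω_uni` is the bimodule map
`Ω_uni → Ω` which sends `d_uni a` to `da`. -/
def fromUniversal [IsScalarTower K Aᵐᵒᵖ Ω] (D : Calculus K A Ω) :
    A ⊗[K] A →ₗ[K] Ω :=
  TensorProduct.lift (LinearMap.mk₂ K (fun r s => op s • D.d r)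
    (fun r r' s => by simp) (fun c r s => by rw [map_smul, smul_comm])
    (fun r s s' => by rw [MulOpposite.op_add, add_smul])
    (fun c r s => by rw [MulOpposite.op_smul, smul_assoc]))

/-- The sub-bimodule `𝒩 ⊆ Ω_uni` with `Ω = Ω_uni / 𝒩`: the kernel of `Ω_uni → Ω`. -/
def N [IsScalarTower K Aᵐᵒᵖ Ω] (D : Calculus K A Ω) :
    Submodule K (A ⊗[K] A) :=
  universalForms K A ⊓ LinearMap.ker D.fromUniversal

/-- For a surjective calculus `Ω_uni → Ω` is onto, so that `Ω = Ω_uni / 𝒩`. -/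
theorem map_fromUniversal [IsScalarTower K Aᵐᵒᵖ Ω]
    (D : Calculus K A Ω) (h : D.IsSurjective) :
    (universalForms K A).map D.fromUniversal = ⊤ := by
  rw [eq_top_iff, ← h, Submodule.span_le]
  rintro _ ⟨a, b, rfl⟩
  refine ⟨(a * b) ⊗ₜ 1 - a ⊗ₜ b, ?_, ?_⟩
  · simp [universalForms]
  · simp [fromUniversal, D.leibniz]

end Calculus

section Duals

variable (K A Ω X Y : Type*) [Field K] [Ring A] [Algebra K A]
  [AddCommGroup Ω] [Module K Ω] [Module A Ω] [Module Aᵐᵒᵖ Ω]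
  [AddCommGroup X] [Module K X] [Module A X] [Module Aᵐᵒᵖ X]
  [AddCommGroup Y] [Module K Y] [Module A Y] [Module Aᵐᵒᵖ Y]

/-- A bimodule map `ev : X ⊗_A Ω → A`. -/
structure LeftPairing where
  ev : X →ₗ[K] Ω →ₗ[K] A
  ev_smul : ∀ (a : A) (x : X) (ξ : Ω), ev (a • x) ξ = a * ev x ξ
  ev_balanced : ∀ (a : A) (x : X) (ξ : Ω), ev (op a • x) ξ = ev x (a • ξ)
  ev_op_smul : ∀ (a : A) (x : X) (ξ : Ω), ev x (op a • ξ) = ev x ξ * a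

/-- A bimodule map `ev : Ω ⊗_A Y → A`. -/
structure RightPairing where
  ev : Ω →ₗ[K] Y →ₗ[K] A
  ev_smul : ∀ (a : A) (ξ : Ω) (y : Y), ev (a • ξ) y = a * ev ξ y
  ev_balanced : ∀ (a : A) (ξ : Ω) (y : Y), ev (op a • ξ) y = ev ξ (a • y)
  ev_op_smul : ∀ (a : A) (ξ : Ω) (y : Y), ev ξ (op a • y) = ev ξ y * a

variable {K A Ω X Y}

/-- `∑ i, ω i ⊗ x i ∈ Ω ⊗_A X` is the value at `1` of a coevaluation `A → Ω ⊗_A X` which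
makes `X` the left dual bimodule of `Ω` with evaluation `ev`. These are the two triangle
identities; they determine `∑ i, ω i ⊗ x i` and imply that it commutes with `A`. -/
def LeftPairing.IsCoev (P : LeftPairing K A Ω X) {n : ℕ} (ω : Fin n → Ω) (x : Fin n → X) :
    Prop :=
  (∀ ξ : Ω, ∑ i, op (P.ev (x i) ξ) • ω i = ξ) ∧ (∀ z : X, ∑ i, P.ev z (ω i) • x i = z)

/-- `∑ j, y j ⊗ ρ j ∈ Y ⊗_A Ω` is the value at `1` of a coevaluation `A → Y ⊗_A Ω` which
makes `Y` the right dual bimodule of `Ω` with evaluation `ev`. -/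
def RightPairing.IsCoev (Q : RightPairing K A Ω Y) {n : ℕ} (y : Fin n → Y) (ρ : Fin n → Ω) :
    Prop :=
  (∀ ξ : Ω, ∑ j, Q.ev ξ (y j) • ρ j = ξ) ∧ (∀ z : Y, ∑ j, op (Q.ev (ρ j) z) • y j = z)

end Duals

/-! ### The algebras -/

section Algebras

variable {K A Ω X Y : Type*} [Field K] [Ring A] [Algebra K A]
  [AddCommGroup Ω] [Module K Ω] [Module A Ω] [Module Aᵐᵒᵖ Ω]
  [AddCommGroup X] [Module K X] [Module A X] [Module Aᵐᵒᵖ X]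
  [AddCommGroup Y] [Module K Y] [Module A Y] [Module Aᵐᵒᵖ Y]

/-- The relations `a • x = ax` and `x • a = xa + ev(x, da)` between the images of `A` and `X`. -/
inductive ConnRel (D : Calculus K A Ω) (P : LeftPairing K A Ω X) {F : Type*} [Ring F]
    (s : A → F) (v : X → F) : F → F → Prop
  | left (a : A) (x : X) : ConnRel D P s v (s a * v x) (v (a • x))
  | right (a : A) (x : X) :
      ConnRel D P s v (v x * s a) (v (op a • x) + s (P.ev x (D.d a)))

/-- The relations of `B𝔛`, between the images `e` of `Aᵉ = A ⊗ Aᵐᵒᵖ`, `v` of `X` and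
`p` of `X ⊗ Ω`. -/
inductive BXRel (D : Calculus K A Ω) (P : LeftPairing K A Ω X) {F : Type*} [Ring F]
    (e : A ⊗[K] Aᵐᵒᵖ → F) (v : X → F) (p : X ⊗[K] Ω → F) : F → F → Prop
  | conn {f g : F} : ConnRel D P (fun a => e (a ⊗ₜ 1)) v f g → BXRel D P e v p f g
  | bar (a : A) (x : X) :
      BXRel D P e v p (v x * e (1 ⊗ₜ op a)) (e (1 ⊗ₜ op a) * v x + p (x ⊗ₜ D.d a))
  | act (a a' b b' : A) (x : X) (ξ : Ω) :
      BXRel D P e v p (e (a ⊗ₜ op a') * p (x ⊗ₜ ξ) * e (b ⊗ₜ op b'))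
        (p ((a • op b • x) ⊗ₜ (b' • op a' • ξ)))

/-- The relations of `IB𝔛`: those of `B𝔛`, and those involving the image `q` of `Ω ⊗ Y`. -/
inductive IBXRel (D : Calculus K A Ω) (P : LeftPairing K A Ω X) (Q : RightPairing K A Ω Y)
    {n m : ℕ} (ω : Fin n → Ω) (x : Fin n → X) (y : Fin m → Y) (ρ : Fin m → Ω)
    {F : Type*} [Ring F]
    (e : A ⊗[K] Aᵐᵒᵖ → F) (v : X → F) (p : X ⊗[K] Ω → F) (q : Ω ⊗[K] Y → F) : F → F → Prop
  | base {f g : F} : BXRel D P e v p f g → IBXRel D P Q ω x y ρ e v p q f g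
  | act (a a' b b' : A) (ξ : Ω) (z : Y) :
      IBXRel D P Q ω x y ρ e v p q (e (a ⊗ₜ op a') * q (ξ ⊗ₜ z) * e (b ⊗ₜ op b'))
        (q ((a • op b • ξ) ⊗ₜ (b' • op a' • z)))
  | inv₁ (ξ : Ω) (z : Y) :
      IBXRel D P Q ω x y ρ e v p q (∑ i, q (ω i ⊗ₜ z) * p (x i ⊗ₜ ξ)) (e (1 ⊗ₜ op (Q.ev ξ z)))
  | inv₂ (z : X) (ξ : Ω) :
      IBXRel D P Q ω x y ρ e v p q (∑ j, p (z ⊗ₜ ρ j) * q (ξ ⊗ₜ y j)) (e (P.ev z ξ ⊗ₜ 1))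

/-- The relations of the second presentation of `B𝔛`, between the images `t` of `Aᵐᵒᵖ`,
`s` of `A` and `v` of `X`. -/
inductive SurjBXRel [IsScalarTower K Aᵐᵒᵖ Ω] (D : Calculus K A Ω)
    {F : Type*} [Ring F] (t : Aᵐᵒᵖ → F) (s : A → F) (v : X → F) : F → F → Prop
  | comm (a b : A) : SurjBXRel D t s v (s a * t (op b)) (t (op b) * s a)
  | surj {n : ℕ} (r r' : Fin n → A) (x : X) (h : ∑ m, r m ⊗ₜ[K] r' m ∈ D.N) :
      SurjBXRel D t s v (∑ m, t (op (r' m)) * v x * t (op (r m))) 0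

/-- The relations of the second presentation of `IB𝔛`, between the images `t` of `Aᵐᵒᵖ`,
`s` of `A`, `v` of `X` and `u` of `Y`. Here `∑ i, db i ⊗ x i` and `∑ j, y j ⊗ dc j` are the
two coevaluations at `1`. -/
inductive SurjIBXRel [IsScalarTower K Aᵐᵒᵖ Ω] (D : Calculus K A Ω)
    (Q : RightPairing K A Ω Y) {n m : ℕ} (b : Fin n → A) (x : Fin n → X)
    (y : Fin m → Y) (c : Fin m → A) {F : Type*} [Ring F]
    (t : Aᵐᵒᵖ → F) (s : A → F) (v : X → F) (u : Y → F) : F → F → Prop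
  | left (a : A) (z : Y) :
      SurjIBXRel D Q b x y c t s v u (t (op a) * u z) (u (op a • z))
  | right (a : A) (z : Y) :
      SurjIBXRel D Q b x y c t s v u (u z * t (op a)) (u (a • z) + t (op (Q.ev (D.d a) z)))
  | surj {k : ℕ} (r r' : Fin k → A) (z : Y) (h : ∑ l, r l ⊗ₜ[K] r' l ∈ D.N) :
      SurjIBXRel D Q b x y c t s v u (∑ l, s (r l) * u z * s (r' l)) 0
  | inv₁ (z : Y) :
      SurjIBXRel D Q b x y c t s v u (∑ i, (u z * s (b i) - s (b i) * u z) * v (x i)) (u z)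
  | inv₂ (z : X) :
      SurjIBXRel D Q b x y c t s v u
        (∑ j, (v z * t (op (c j)) - t (op (c j)) * v z) * u (y j)) (v z)

end Algebras

/-! #### The algebra `B𝔛`, a quotient of `Aᵉ ⋆ T X ⋆ T (X ⊗ Ω)` -/

section BX

variable (K A Ω X : Type*) [Field K] [Ring A] [Algebra K A]
  [AddCommGroup Ω] [Module K Ω] [AddCommGroup X] [Module K X]

/-- `Aᵉ ⋆ T X ⋆ T (X ⊗ Ω)`. -/
abbrev BXFree : Type _ :=
  Coprod K (Coprod K (A ⊗[K] Aᵐᵒᵖ) (TensorAlgebra K X)) (TensorAlgebra K (X ⊗[K] Ω))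

def BXFree.e : A ⊗[K] Aᵐᵒᵖ →ₐ[K] BXFree K A Ω X := (Coprod.inl K _ _).comp (Coprod.inl K _ _)

def BXFree.v : X →ₗ[K] BXFree K A Ω X :=
  ((Coprod.inl K _ _).comp (Coprod.inr K _ _)).toLinearMap ∘ₗ TensorAlgebra.ι K

def BXFree.p : X ⊗[K] Ω →ₗ[K] BXFree K A Ω X :=
  (Coprod.inr K _ _).toLinearMap ∘ₗ TensorAlgebra.ι K

variable {K A Ω X} [Module A Ω] [Module Aᵐᵒᵖ Ω] [Module A X] [Module Aᵐᵒᵖ X]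

/-- The relations of `B𝔛` in `Aᵉ ⋆ T X ⋆ T (X ⊗ Ω)`. -/
abbrev BXr (D : Calculus K A Ω) (P : LeftPairing K A Ω X) :
    BXFree K A Ω X → BXFree K A Ω X → Prop :=
  BXRel D P (BXFree.e K A Ω X) (BXFree.v K A Ω X) (BXFree.p K A Ω X)

/-- The algebra `B𝔛`. -/
abbrev BX (D : Calculus K A Ω) (P : LeftPairing K A Ω X) : Type _ := RingQuot (BXr D P)

variable (D : Calculus K A Ω) (P : LeftPairing K A Ω X)

def BX.e : A ⊗[K] Aᵐᵒᵖ →ₐ[K] BX D P :=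
  (RingQuot.mkAlgHom K (BXr D P)).comp (BXFree.e K A Ω X)

def BX.v : X →ₗ[K] BX D P :=
  (RingQuot.mkAlgHom K (BXr D P)).toLinearMap ∘ₗ BXFree.v K A Ω X

def BX.p : X ⊗[K] Ω →ₗ[K] BX D P :=
  (RingQuot.mkAlgHom K (BXr D P)).toLinearMap ∘ₗ BXFree.p K A Ω X

end BX

/-! #### The algebra `IB𝔛`, a quotient of `Aᵉ ⋆ T X ⋆ T (X ⊗ Ω) ⋆ T (Ω ⊗ Y)` -/

section IBX

variable (K A Ω X Y : Type*) [Field K] [Ring A] [Algebra K A]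
  [AddCommGroup Ω] [Module K Ω] [AddCommGroup X] [Module K X] [AddCommGroup Y] [Module K Y]

/-- `Aᵉ ⋆ T X ⋆ T (X ⊗ Ω) ⋆ T (Ω ⊗ Y)`. -/
abbrev IBXFree : Type _ := Coprod K (BXFree K A Ω X) (TensorAlgebra K (Ω ⊗[K] Y))

def IBXFree.e : A ⊗[K] Aᵐᵒᵖ →ₐ[K] IBXFree K A Ω X Y :=
  (Coprod.inl K _ _).comp (BXFree.e K A Ω X)

def IBXFree.v : X →ₗ[K] IBXFree K A Ω X Y := (Coprod.inl K _ _).toLinearMap ∘ₗ BXFree.v K A Ω X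

def IBXFree.p : X ⊗[K] Ω →ₗ[K] IBXFree K A Ω X Y :=
  (Coprod.inl K _ _).toLinearMap ∘ₗ BXFree.p K A Ω X

def IBXFree.q : Ω ⊗[K] Y →ₗ[K] IBXFree K A Ω X Y :=
  (Coprod.inr K _ _).toLinearMap ∘ₗ TensorAlgebra.ι K

variable {K A Ω X Y} [Module A Ω] [Module Aᵐᵒᵖ Ω] [Module A X] [Module Aᵐᵒᵖ X]
  [Module A Y] [Module Aᵐᵒᵖ Y]

/-- The relations of `IB𝔛` in `Aᵉ ⋆ T X ⋆ T (X ⊗ Ω) ⋆ T (Ω ⊗ Y)`. -/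
abbrev IBXr (D : Calculus K A Ω) (P : LeftPairing K A Ω X) (Q : RightPairing K A Ω Y)
    {n m : ℕ} (ω : Fin n → Ω) (x : Fin n → X) (y : Fin m → Y) (ρ : Fin m → Ω) :
    IBXFree K A Ω X Y → IBXFree K A Ω X Y → Prop :=
  IBXRel D P Q ω x y ρ (IBXFree.e K A Ω X Y) (IBXFree.v K A Ω X Y) (IBXFree.p K A Ω X Y)
    (IBXFree.q K A Ω X Y)

/-- The algebra `IB𝔛`, where `∑ i, ω i ⊗ x i` and `∑ j, y j ⊗ ρ j` are the two coevaluations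
at `1`. -/
abbrev IBX (D : Calculus K A Ω) (P : LeftPairing K A Ω X) (Q : RightPairing K A Ω Y)
    {n m : ℕ} (ω : Fin n → Ω) (x : Fin n → X) (y : Fin m → Y) (ρ : Fin m → Ω) : Type _ :=
  RingQuot (IBXr D P Q ω x y ρ)

variable (D : Calculus K A Ω) (P : LeftPairing K A Ω X) (Q : RightPairing K A Ω Y)
    {n m : ℕ} (ω : Fin n → Ω) (x : Fin n → X) (y : Fin m → Y) (ρ : Fin m → Ω)

def IBX.e : A ⊗[K] Aᵐᵒᵖ →ₐ[K] IBX D P Q ω x y ρ :=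
  (RingQuot.mkAlgHom K (IBXr D P Q ω x y ρ)).comp (IBXFree.e K A Ω X Y)

def IBX.v : X →ₗ[K] IBX D P Q ω x y ρ :=
  (RingQuot.mkAlgHom K (IBXr D P Q ω x y ρ)).toLinearMap ∘ₗ IBXFree.v K A Ω X Y

def IBX.p : X ⊗[K] Ω →ₗ[K] IBX D P Q ω x y ρ :=
  (RingQuot.mkAlgHom K (IBXr D P Q ω x y ρ)).toLinearMap ∘ₗ IBXFree.p K A Ω X Y

def IBX.q : Ω ⊗[K] Y →ₗ[K] IBX D P Q ω x y ρ :=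
  (RingQuot.mkAlgHom K (IBXr D P Q ω x y ρ)).toLinearMap ∘ₗ IBXFree.q K A Ω X Y

end IBX

/-! #### The algebra `T𝔛` of left connections, and the second presentation of `B𝔛` -/

section SurjBX

variable {K A Ω X : Type*} [Field K] [Ring A] [Algebra K A]
  [AddCommGroup Ω] [Module K Ω] [Module A Ω] [Module Aᵐᵒᵖ Ω]
  [AddCommGroup X] [Module K X] [Module A X] [Module Aᵐᵒᵖ X]
  (D : Calculus K A Ω) (P : LeftPairing K A Ω X)

/-- The relations of `T𝔛` in `A ⋆ T X`. -/
abbrev TXr : Coprod K A (TensorAlgebra K X) → Coprod K A (TensorAlgebra K X) → Prop :=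
  ConnRel D P (Coprod.inl K A (TensorAlgebra K X))
    (fun x => Coprod.inr K A (TensorAlgebra K X) (TensorAlgebra.ι K x))

/-- The algebra `T𝔛`. -/
abbrev TX : Type _ := RingQuot (TXr D P)

def TX.s : A →ₐ[K] TX D P := (RingQuot.mkAlgHom K (TXr D P)).comp (Coprod.inl K _ _)

def TX.v : X →ₗ[K] TX D P :=
  ((RingQuot.mkAlgHom K (TXr D P)).comp (Coprod.inr K _ _)).toLinearMap ∘ₗ TensorAlgebra.ι K

variable [IsScalarTower K Aᵐᵒᵖ Ω]

/-- The relations of the second presentation of `B𝔛` in `Aᵐᵒᵖ ⋆ T𝔛`. -/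
abbrev SurjBXr : Coprod K Aᵐᵒᵖ (TX D P) → Coprod K Aᵐᵒᵖ (TX D P) → Prop :=
  SurjBXRel D (Coprod.inl K Aᵐᵒᵖ (TX D P))
    (fun a => Coprod.inr K Aᵐᵒᵖ (TX D P) (TX.s D P a))
    (fun x => Coprod.inr K Aᵐᵒᵖ (TX D P) (TX.v D P x))

/-- The second presentation of `B𝔛`. -/
abbrev SurjBX : Type _ := RingQuot (SurjBXr D P)

def SurjBX.t : Aᵐᵒᵖ →ₐ[K] SurjBX D P :=
  (RingQuot.mkAlgHom K (SurjBXr D P)).comp (Coprod.inl K _ _)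

def SurjBX.s : A →ₐ[K] SurjBX D P :=
  ((RingQuot.mkAlgHom K (SurjBXr D P)).comp (Coprod.inr K _ _)).comp (TX.s D P)

def SurjBX.v : X →ₗ[K] SurjBX D P :=
  ((RingQuot.mkAlgHom K (SurjBXr D P)).comp (Coprod.inr K _ _)).toLinearMap ∘ₗ TX.v D P

end SurjBX

/-! #### The second presentation of `IB𝔛`, a quotient of `B𝔛 ⋆ T Y` -/

section SurjIBX

variable {K A Ω X Y : Type*} [Field K] [Ring A] [Algebra K A]
  [AddCommGroup Ω] [Module K Ω] [Module A Ω] [Module Aᵐᵒᵖ Ω]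
  [AddCommGroup X] [Module K X] [Module A X] [Module Aᵐᵒᵖ X]
  [AddCommGroup Y] [Module K Y] [Module A Y] [Module Aᵐᵒᵖ Y]
  [IsScalarTower K Aᵐᵒᵖ Ω]
  (D : Calculus K A Ω) (P : LeftPairing K A Ω X) (Q : RightPairing K A Ω Y)
  {n m : ℕ} (b : Fin n → A) (x : Fin n → X) (y : Fin m → Y) (c : Fin m → A)

/-- The relations of the second presentation of `IB𝔛` in `B𝔛 ⋆ T Y`. -/
abbrev SurjIBXr : Coprod K (SurjBX D P) (TensorAlgebra K Y) →
    Coprod K (SurjBX D P) (TensorAlgebra K Y) → Prop :=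
  SurjIBXRel D Q b x y c
    (fun a => Coprod.inl K (SurjBX D P) (TensorAlgebra K Y) (SurjBX.t D P a))
    (fun a => Coprod.inl K (SurjBX D P) (TensorAlgebra K Y) (SurjBX.s D P a))
    (fun z => Coprod.inl K (SurjBX D P) (TensorAlgebra K Y) (SurjBX.v D P z))
    (fun z => Coprod.inr K (SurjBX D P) (TensorAlgebra K Y) (TensorAlgebra.ι K z))

/-- The second presentation of `IB𝔛`. -/
abbrev SurjIBX : Type _ := RingQuot (SurjIBXr D P Q b x y c)

/-- The canonical map from the second presentation of `B𝔛`. -/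
def SurjIBX.ofBX : SurjBX D P →ₐ[K] SurjIBX D P Q b x y c :=
  (RingQuot.mkAlgHom K (SurjIBXr D P Q b x y c)).comp (Coprod.inl K _ _)

def SurjIBX.t : Aᵐᵒᵖ →ₐ[K] SurjIBX D P Q b x y c :=
  (SurjIBX.ofBX D P Q b x y c).comp (SurjBX.t D P)

def SurjIBX.s : A →ₐ[K] SurjIBX D P Q b x y c :=
  (SurjIBX.ofBX D P Q b x y c).comp (SurjBX.s D P)

def SurjIBX.v : X →ₗ[K] SurjIBX D P Q b x y c :=
  (SurjIBX.ofBX D P Q b x y c).toLinearMap ∘ₗ SurjBX.v D P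

def SurjIBX.u : Y →ₗ[K] SurjIBX D P Q b x y c :=
  ((RingQuot.mkAlgHom K (SurjIBXr D P Q b x y c)).comp (Coprod.inr K _ _)).toLinearMap ∘ₗ
    TensorAlgebra.ι K

end SurjIBX

end

end SurjCalc

/-!
Both presentations of `B𝔛` represent the same functor. A map out of `B𝔛` amounts to maps
`s`, `t`, `v`, `p` on `A`, `Aᵐᵒᵖ`, `X`, `X ⊗ Ω`, in which `p (x ⊗ a db) = ⁅v x, t b⁆ * t a` is
determined by the others. Conversely commutators with `v x` define such a `p` exactly when
`∑ r ⊗ r' ↦ ∑ t r' * v x * t r` vanishes on `𝒩`, because `Ω = Ω_uni / 𝒩`.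

In `IB𝔛` the same holds for `q (a db ⊗ y) = s a * ⁅u y, s b⁆`, where `u` is recovered from `q` as
`u y = ∑ q (db_i ⊗ y) * v x'_i`. The coevaluation is central, so moving `s a` through this sum
produces only the defect `∑ q (db_i ⊗ y) * s (ev (x'_i, da)) = q (da ⊗ y)` of the right
connection rule: this is the identity `⁅u y, s a⁆ = q (da ⊗ y)`.
-/

namespace SurjCalc

noncomputable section

/-! ### Universal properties -/

namespace Coprod

variable {K R S B : Type*} [CommRing K] [Semiring R] [Semiring S] [Algebra K R] [Algebra K S]
  [Semiring B] [Algebra K B]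

/-- The algebra map out of a free product given by its restrictions to the two factors. -/
def lift (f : R →ₐ[K] B) (g : S →ₐ[K] B) : Coprod K R S →ₐ[K] B :=
  LinearAlgebra.FreeProduct.lift K (Pair R S) fun {i} =>
    match i with
    | false => f.comp (ULift.algEquiv (R := K) (A := R)).toAlgHom
    | true => g.comp (ULift.algEquiv (R := K) (A := S)).toAlgHom

@[simp]
theorem lift_inl (f : R →ₐ[K] B) (g : S →ₐ[K] B) (r : R) : lift f g (inl K R S r) = f r :=
  DFunLike.congr_fun (LinearAlgebra.FreeProduct.lift_comp_ι (i := false) K (Pair R S) _)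
    (ULift.up r)

@[simp]
theorem lift_inr (f : R →ₐ[K] B) (g : S →ₐ[K] B) (s : S) : lift f g (inr K R S s) = g s :=
  DFunLike.congr_fun (LinearAlgebra.FreeProduct.lift_comp_ι (i := true) K (Pair R S) _)
    (ULift.up s)

theorem algHom_ext {f g : Coprod K R S →ₐ[K] B} (hl : f.comp (inl K R S) = g.comp (inl K R S))
    (hr : f.comp (inr K R S) = g.comp (inr K R S)) : f = g := by
  apply (LinearAlgebra.FreeProduct.lift K (Pair R S)).symm.injective
  funext i
  cases i with
  | false => exact AlgHom.ext fun r => DFunLike.congr_fun hl r.down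
  | true => exact AlgHom.ext fun s => DFunLike.congr_fun hr s.down

end Coprod

section UniversalProperties

variable {K A Ω X Y F F' : Type*} [Field K] [Ring A] [Algebra K A]
  [AddCommGroup Ω] [Module K Ω] [Module A Ω] [Module Aᵐᵒᵖ Ω]
  [AddCommGroup X] [Module K X] [Module A X] [Module Aᵐᵒᵖ X]
  [AddCommGroup Y] [Module K Y] [Module A Y] [Module Aᵐᵒᵖ Y]
  [Ring F] [Algebra K F] [Ring F'] [Algebra K F']

namespace TX

/-- The relations of `T𝔛` hold for maps `s`, `v` on `A`, `X` into an algebra. -/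
structure Relations (D : Calculus K A Ω) (P : LeftPairing K A Ω X)
    (s : A →ₐ[K] F) (v : X →ₗ[K] F) : Prop where
  s_mul_v : ∀ a x, s a * v x = v (a • x)
  v_mul_s : ∀ a x, v x * s a = v (op a • x) + s (P.ev x (D.d a))

variable {D : Calculus K A Ω} {P : LeftPairing K A Ω X}
  {s : A →ₐ[K] F} {v : X →ₗ[K] F} {s' : A →ₐ[K] F'} {v' : X →ₗ[K] F'}

theorem Relations.map (h : Relations D P s v) (φ : F →ₐ[K] F') :
    Relations D P (φ.comp s) (φ.toLinearMap ∘ₗ v) where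
  s_mul_v a x := by simpa using congrArg φ (h.s_mul_v a x)
  v_mul_s a x := by simpa using congrArg φ (h.v_mul_s a x)

theorem Relations.of_rel {φ : F →ₐ[K] F'} (H : ∀ {f g}, ConnRel D P s v f g → φ f = φ g) :
    Relations D P (φ.comp s) (φ.toLinearMap ∘ₗ v) where
  s_mul_v a x := by simpa using H (.left a x)
  v_mul_s a x := by simpa using H (.right a x)

theorem Relations.map_eq_of_rel (h : Relations D P s' v') (φ : F →ₐ[K] F') {s : A → F} {v : X → F}
    (hs : ∀ a, φ (s a) = s' a) (hv : ∀ x, φ (v x) = v' x) {f g : F} (r : ConnRel D P s v f g) :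
    φ f = φ g := by
  cases r with
  | left a x => simp [hs, hv, h.s_mul_v]
  | right a x => simp [hs, hv, h.v_mul_s]

theorem relations : Relations (F := TX D P) D P (TX.s D P) (TX.v D P) :=
  .of_rel (v := (Coprod.inr K A (TensorAlgebra K X)).toLinearMap ∘ₗ TensorAlgebra.ι K)
    fun r => RingQuot.mkAlgHom_rel K r

/-- The algebra map out of `T𝔛` given by maps `s`, `v` which satisfy its relations. -/
def lift (h : Relations D P s v) : TX D P →ₐ[K] F :=
  RingQuot.liftAlgHom K ⟨Coprod.lift s (TensorAlgebra.lift K v), fun _ _ r =>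
    h.map_eq_of_rel _ (by simp) (by simp) r⟩

@[simp]
theorem lift_s (h : Relations D P s v) (a : A) : lift h (TX.s D P a) = s a := by
  simp [lift, TX.s]

@[simp]
theorem lift_v (h : Relations D P s v) (x : X) : lift h (TX.v D P x) = v x := by
  simp [lift, TX.v]

theorem algHom_ext {f g : TX D P →ₐ[K] F} (hs : ∀ a, f (TX.s D P a) = g (TX.s D P a))
    (hv : ∀ x, f (TX.v D P x) = g (TX.v D P x)) : f = g :=
  RingQuot.ringQuot_ext' _ _ _ (Coprod.algHom_ext (AlgHom.ext hs)
    (TensorAlgebra.hom_ext (LinearMap.ext hv)))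

end TX

/-- The map from the free algebra on the generators of `B𝔛` given by its values on them. -/
def BXFree.lift (e : A ⊗[K] Aᵐᵒᵖ →ₐ[K] F) (v : X →ₗ[K] F) (p : X ⊗[K] Ω →ₗ[K] F) :
    BXFree K A Ω X →ₐ[K] F :=
  Coprod.lift (Coprod.lift e (TensorAlgebra.lift K v)) (TensorAlgebra.lift K p)

namespace BX

/-- The relations of `B𝔛` hold for maps `s`, `t`, `v`, `p` on `A`, `Aᵐᵒᵖ`, `X`, `X ⊗ Ω` into an
algebra. The bimodule relation for `p` is split into its four one-sided cases. -/
structure Relations (D : Calculus K A Ω) (P : LeftPairing K A Ω X)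
    (s : A →ₐ[K] F) (t : Aᵐᵒᵖ →ₐ[K] F) (v : X →ₗ[K] F) (p : X ⊗[K] Ω →ₗ[K] F) : Prop extends
    toTX : TX.Relations D P s v where
  commute : ∀ a b, Commute (s a) (t b)
  v_mul_t : ∀ a x, v x * t (op a) = t (op a) * v x + p (x ⊗ₜ D.d a)
  s_mul_p : ∀ a x ξ, s a * p (x ⊗ₜ ξ) = p ((a • x) ⊗ₜ ξ)
  t_mul_p : ∀ a x ξ, t (op a) * p (x ⊗ₜ ξ) = p (x ⊗ₜ (op a • ξ))
  p_mul_s : ∀ a x ξ, p (x ⊗ₜ ξ) * s a = p ((op a • x) ⊗ₜ ξ)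
  p_mul_t : ∀ a x ξ, p (x ⊗ₜ ξ) * t (op a) = p (x ⊗ₜ (a • ξ))

variable {D : Calculus K A Ω} {P : LeftPairing K A Ω X}

variable (D P) in
/-- The map `A → B𝔛`. -/
def s : A →ₐ[K] BX D P := (BX.e D P).comp Algebra.TensorProduct.includeLeft

variable (D P) in
/-- The map `Aᵐᵒᵖ → B𝔛`. -/
def t : Aᵐᵒᵖ →ₐ[K] BX D P := (BX.e D P).comp Algebra.TensorProduct.includeRight

variable {s : A →ₐ[K] F} {t : Aᵐᵒᵖ →ₐ[K] F} {v : X →ₗ[K] F} {p : X ⊗[K] Ω →ₗ[K] F}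

theorem Relations.mul_p_mul (h : Relations D P s t v p) (a a' b b' : A) (x : X) (ξ : Ω) :
    s a * t (op a') * p (x ⊗ₜ ξ) * (s b * t (op b')) =
      p ((a • op b • x) ⊗ₜ (b' • op a' • ξ)) := by
  rw [mul_assoc (s a), h.t_mul_p, mul_assoc, ← mul_assoc (p _), h.p_mul_s, h.p_mul_t, h.s_mul_p]

theorem Relations.map_eq_of_rel (h : Relations D P s t v p) (φ : F' →ₐ[K] F)
    {e' : A ⊗[K] Aᵐᵒᵖ → F'} {v' : X → F'} {p' : X ⊗[K] Ω → F'}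
    (he : ∀ a a', φ (e' (a ⊗ₜ a')) = s a * t a') (hv : ∀ x, φ (v' x) = v x)
    (hp : ∀ z, φ (p' z) = p z) {f g : F'} (r : BXRel D P e' v' p' f g) : φ f = φ g := by
  cases r with
  | conn r => exact h.toTX.map_eq_of_rel φ (by simp [he]) hv r
  | bar a x => simp [he, hv, hp, h.v_mul_t]
  | act a a' b b' x ξ => simp [he, hp, h.mul_p_mul]

theorem Relations.of_rel {e : A ⊗[K] Aᵐᵒᵖ →ₐ[K] F} {φ : F →ₐ[K] F'}
    (H : ∀ {f g}, BXRel D P e v p f g → φ f = φ g) :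
    Relations D P ((φ.comp e).comp Algebra.TensorProduct.includeLeft)
      ((φ.comp e).comp Algebra.TensorProduct.includeRight)
      (φ.toLinearMap ∘ₗ v) (φ.toLinearMap ∘ₗ p) where
  s_mul_v a x := by simpa using H (.conn (.left a x))
  v_mul_s a x := by simpa using H (.conn (.right a x))
  commute a b := by simp [commute_iff_eq, ← map_mul]
  v_mul_t a x := by simpa using H (.bar a x)
  s_mul_p a x ξ := by simpa [← Algebra.TensorProduct.one_def] using H (.act a 1 1 1 x ξ)
  t_mul_p a x ξ := by simpa [← Algebra.TensorProduct.one_def] using H (.act 1 a 1 1 x ξ)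
  p_mul_s a x ξ := by simpa [← Algebra.TensorProduct.one_def] using H (.act 1 1 a 1 x ξ)
  p_mul_t a x ξ := by simpa [← Algebra.TensorProduct.one_def] using H (.act 1 1 1 a x ξ)

theorem relations :
    Relations (F := BX D P) D P (BX.s D P) (BX.t D P) (BX.v D P) (BX.p D P) :=
  .of_rel fun r => RingQuot.mkAlgHom_rel K r

/-- The algebra map out of `B𝔛` given by maps `s`, `t`, `v`, `p` which satisfy its relations. -/
def lift (h : Relations D P s t v p) : BX D P →ₐ[K] F :=
  RingQuot.liftAlgHom K ⟨BXFree.lift (Algebra.TensorProduct.lift s t h.commute) v p, fun _ _ r =>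
    h.map_eq_of_rel _ (by simp [BXFree.lift, BXFree.e]) (by simp [BXFree.lift, BXFree.v])
      (by simp [BXFree.lift, BXFree.p]) r⟩

@[simp]
theorem lift_e (h : Relations D P s t v p) (a : A) (a' : Aᵐᵒᵖ) :
    lift h (BX.e D P (a ⊗ₜ a')) = s a * t a' := by
  simp [lift, BX.e, BXFree.lift, BXFree.e]

@[simp]
theorem lift_s (h : Relations D P s t v p) (a : A) : lift h (BX.s D P a) = s a := by
  simp [BX.s]

@[simp]
theorem lift_t (h : Relations D P s t v p) (a : Aᵐᵒᵖ) : lift h (BX.t D P a) = t a := by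
  simp [BX.t]

@[simp]
theorem lift_v (h : Relations D P s t v p) (x : X) : lift h (BX.v D P x) = v x := by
  simp [lift, BX.v, BXFree.lift, BXFree.v]

@[simp]
theorem lift_p (h : Relations D P s t v p) (z : X ⊗[K] Ω) : lift h (BX.p D P z) = p z := by
  simp [lift, BX.p, BXFree.lift, BXFree.p]

theorem algHom_ext {f g : BX D P →ₐ[K] F} (hs : ∀ a, f (BX.s D P a) = g (BX.s D P a))
    (ht : ∀ a, f (BX.t D P a) = g (BX.t D P a)) (hv : ∀ x, f (BX.v D P x) = g (BX.v D P x))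
    (hp : ∀ x ξ, f (BX.p D P (x ⊗ₜ ξ)) = g (BX.p D P (x ⊗ₜ ξ))) : f = g := by
  refine RingQuot.ringQuot_ext' _ _ _ (Coprod.algHom_ext (Coprod.algHom_ext ?_ ?_) ?_)
  · exact Algebra.TensorProduct.ext (AlgHom.ext hs) (AlgHom.ext ht)
  · exact TensorAlgebra.hom_ext (LinearMap.ext hv)
  · exact TensorAlgebra.hom_ext (TensorProduct.ext' hp)

end BX

/-- The map from the free algebra on the generators of `IB𝔛` given by its values on them. -/
def IBXFree.lift (e : A ⊗[K] Aᵐᵒᵖ →ₐ[K] F) (v : X →ₗ[K] F) (p : X ⊗[K] Ω →ₗ[K] F)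
    (q : Ω ⊗[K] Y →ₗ[K] F) : IBXFree K A Ω X Y →ₐ[K] F :=
  Coprod.lift (BXFree.lift e v p) (TensorAlgebra.lift K q)

namespace IBX

/-- The relations of `IB𝔛` hold for maps `s`, `t`, `v`, `p`, `q` on `A`, `Aᵐᵒᵖ`, `X`, `X ⊗ Ω`,
`Ω ⊗ Y` into an algebra. -/
structure Relations (D : Calculus K A Ω) (P : LeftPairing K A Ω X) (Q : RightPairing K A Ω Y)
    {n m : ℕ} (ω : Fin n → Ω) (x : Fin n → X) (y : Fin m → Y) (ρ : Fin m → Ω)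
    (s : A →ₐ[K] F) (t : Aᵐᵒᵖ →ₐ[K] F) (v : X →ₗ[K] F) (p : X ⊗[K] Ω →ₗ[K] F)
    (q : Ω ⊗[K] Y →ₗ[K] F) : Prop extends toBX : BX.Relations D P s t v p where
  s_mul_q : ∀ a ξ z, s a * q (ξ ⊗ₜ z) = q ((a • ξ) ⊗ₜ z)
  t_mul_q : ∀ a ξ z, t (op a) * q (ξ ⊗ₜ z) = q (ξ ⊗ₜ (op a • z))
  q_mul_s : ∀ a ξ z, q (ξ ⊗ₜ z) * s a = q ((op a • ξ) ⊗ₜ z)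
  q_mul_t : ∀ a ξ z, q (ξ ⊗ₜ z) * t (op a) = q (ξ ⊗ₜ (a • z))
  sum_q_mul_p : ∀ ξ z, ∑ i, q (ω i ⊗ₜ z) * p (x i ⊗ₜ ξ) = t (op (Q.ev ξ z))
  sum_p_mul_q : ∀ z ξ, ∑ j, p (z ⊗ₜ ρ j) * q (ξ ⊗ₜ y j) = s (P.ev z ξ)

variable {D : Calculus K A Ω} {P : LeftPairing K A Ω X} {Q : RightPairing K A Ω Y}
  {n m : ℕ} {ω : Fin n → Ω} {x : Fin n → X} {y : Fin m → Y} {ρ : Fin m → Ω}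

variable (D P Q ω x y ρ) in
/-- The map `A → IB𝔛`. -/
def s : A →ₐ[K] IBX D P Q ω x y ρ :=
  (IBX.e D P Q ω x y ρ).comp Algebra.TensorProduct.includeLeft

variable (D P Q ω x y ρ) in
/-- The map `Aᵐᵒᵖ → IB𝔛`. -/
def t : Aᵐᵒᵖ →ₐ[K] IBX D P Q ω x y ρ :=
  (IBX.e D P Q ω x y ρ).comp Algebra.TensorProduct.includeRight

variable {s : A →ₐ[K] F} {t : Aᵐᵒᵖ →ₐ[K] F} {v : X →ₗ[K] F} {p : X ⊗[K] Ω →ₗ[K] F}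
  {q : Ω ⊗[K] Y →ₗ[K] F}

theorem Relations.mul_q_mul (h : Relations D P Q ω x y ρ s t v p q) (a a' b b' : A) (ξ : Ω)
    (z : Y) :
    s a * t (op a') * q (ξ ⊗ₜ z) * (s b * t (op b')) =
      q ((a • op b • ξ) ⊗ₜ (b' • op a' • z)) := by
  rw [mul_assoc (s a), h.t_mul_q, mul_assoc, ← mul_assoc (q _), h.q_mul_s, h.q_mul_t, h.s_mul_q]

theorem Relations.map_eq_of_rel (h : Relations D P Q ω x y ρ s t v p q) (φ : F' →ₐ[K] F)
    {e' : A ⊗[K] Aᵐᵒᵖ → F'} {v' : X → F'} {p' : X ⊗[K] Ω → F'} {q' : Ω ⊗[K] Y → F'}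
    (he : ∀ a a', φ (e' (a ⊗ₜ a')) = s a * t a') (hv : ∀ x, φ (v' x) = v x)
    (hp : ∀ z, φ (p' z) = p z) (hq : ∀ z, φ (q' z) = q z) {f g : F'}
    (r : IBXRel D P Q ω x y ρ e' v' p' q' f g) : φ f = φ g := by
  cases r with
  | base r => exact h.toBX.map_eq_of_rel φ he hv hp r
  | act a a' b b' ξ z => simp [he, hq, h.mul_q_mul]
  | inv₁ ξ z => simp [he, hp, hq, h.sum_q_mul_p]
  | inv₂ z ξ => simp [he, hp, hq, h.sum_p_mul_q]

theorem Relations.of_rel {e : A ⊗[K] Aᵐᵒᵖ →ₐ[K] F} {φ : F →ₐ[K] F'}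
    (H : ∀ {f g}, IBXRel D P Q ω x y ρ e v p q f g → φ f = φ g) :
    Relations D P Q ω x y ρ ((φ.comp e).comp Algebra.TensorProduct.includeLeft)
      ((φ.comp e).comp Algebra.TensorProduct.includeRight)
      (φ.toLinearMap ∘ₗ v) (φ.toLinearMap ∘ₗ p) (φ.toLinearMap ∘ₗ q) where
  toBX := .of_rel fun r => H (.base r)
  s_mul_q a ξ z := by simpa [← Algebra.TensorProduct.one_def] using H (.act a 1 1 1 ξ z)
  t_mul_q a ξ z := by simpa [← Algebra.TensorProduct.one_def] using H (.act 1 a 1 1 ξ z)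
  q_mul_s a ξ z := by simpa [← Algebra.TensorProduct.one_def] using H (.act 1 1 a 1 ξ z)
  q_mul_t a ξ z := by simpa [← Algebra.TensorProduct.one_def] using H (.act 1 1 1 a ξ z)
  sum_q_mul_p ξ z := by simpa using H (.inv₁ ξ z)
  sum_p_mul_q z ξ := by simpa using H (.inv₂ z ξ)

theorem relations : Relations (F := IBX D P Q ω x y ρ) D P Q ω x y ρ
    (IBX.s D P Q ω x y ρ) (IBX.t D P Q ω x y ρ)
    (IBX.v D P Q ω x y ρ) (IBX.p D P Q ω x y ρ) (IBX.q D P Q ω x y ρ) :=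
  .of_rel fun r => RingQuot.mkAlgHom_rel K r

/-- The algebra map out of `IB𝔛` given by maps `s`, `t`, `v`, `p`, `q` which satisfy its
relations. -/
def lift (h : Relations D P Q ω x y ρ s t v p q) : IBX D P Q ω x y ρ →ₐ[K] F :=
  RingQuot.liftAlgHom K ⟨IBXFree.lift (Algebra.TensorProduct.lift s t h.commute) v p q,
    fun _ _ r => h.map_eq_of_rel _ (by simp [IBXFree.lift, BXFree.lift, IBXFree.e, BXFree.e])
      (by simp [IBXFree.lift, BXFree.lift, IBXFree.v, BXFree.v])
      (by simp [IBXFree.lift, BXFree.lift, IBXFree.p, BXFree.p])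
      (by simp [IBXFree.lift, IBXFree.q]) r⟩

section lift

variable (h : Relations D P Q ω x y ρ s t v p q)

@[simp]
theorem lift_e (a : A) (a' : Aᵐᵒᵖ) : lift h (IBX.e D P Q ω x y ρ (a ⊗ₜ a')) = s a * t a' := by
  simp [lift, IBX.e, IBXFree.lift, BXFree.lift, IBXFree.e, BXFree.e]

@[simp]
theorem lift_s (a : A) : lift h (IBX.s D P Q ω x y ρ a) = s a := by
  simp [IBX.s]

@[simp]
theorem lift_t (a : Aᵐᵒᵖ) : lift h (IBX.t D P Q ω x y ρ a) = t a := by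
  simp [IBX.t]

@[simp]
theorem lift_v (z : X) : lift h (IBX.v D P Q ω x y ρ z) = v z := by
  simp [lift, IBX.v, IBXFree.lift, BXFree.lift, IBXFree.v, BXFree.v]

@[simp]
theorem lift_p (z : X ⊗[K] Ω) : lift h (IBX.p D P Q ω x y ρ z) = p z := by
  simp [lift, IBX.p, IBXFree.lift, BXFree.lift, IBXFree.p, BXFree.p]

@[simp]
theorem lift_q (z : Ω ⊗[K] Y) : lift h (IBX.q D P Q ω x y ρ z) = q z := by
  simp [lift, IBX.q, IBXFree.lift, IBXFree.q]

end lift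

theorem algHom_ext {f g : IBX D P Q ω x y ρ →ₐ[K] F}
    (hs : ∀ a, f (IBX.s D P Q ω x y ρ a) = g (IBX.s D P Q ω x y ρ a))
    (ht : ∀ a, f (IBX.t D P Q ω x y ρ a) = g (IBX.t D P Q ω x y ρ a))
    (hv : ∀ z, f (IBX.v D P Q ω x y ρ z) = g (IBX.v D P Q ω x y ρ z))
    (hp : ∀ z ξ, f (IBX.p D P Q ω x y ρ (z ⊗ₜ ξ)) = g (IBX.p D P Q ω x y ρ (z ⊗ₜ ξ)))
    (hq : ∀ ξ z, f (IBX.q D P Q ω x y ρ (ξ ⊗ₜ z)) = g (IBX.q D P Q ω x y ρ (ξ ⊗ₜ z))) :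
    f = g := by
  refine RingQuot.ringQuot_ext' _ _ _ (Coprod.algHom_ext
    (Coprod.algHom_ext (Coprod.algHom_ext ?_ ?_) ?_) ?_)
  · exact Algebra.TensorProduct.ext (AlgHom.ext hs) (AlgHom.ext ht)
  · exact TensorAlgebra.hom_ext (LinearMap.ext hv)
  · exact TensorAlgebra.hom_ext (TensorProduct.ext' hp)
  · exact TensorAlgebra.hom_ext (TensorProduct.ext' hq)

end IBX

variable [IsScalarTower K Aᵐᵒᵖ Ω]

namespace SurjBX

/-- The relations of the second presentation of `B𝔛` hold for maps `s`, `t`, `v` on `A`, `Aᵐᵒᵖ`,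
`X` into an algebra. -/
structure Relations (D : Calculus K A Ω) (P : LeftPairing K A Ω X)
    (s : A →ₐ[K] F) (t : Aᵐᵒᵖ →ₐ[K] F) (v : X →ₗ[K] F) : Prop extends
    toTX : TX.Relations D P s v where
  commute : ∀ a b, Commute (s a) (t b)
  sum_t_mul_v_mul_t : ∀ {n : ℕ} (r r' : Fin n → A) (x : X), ∑ m, r m ⊗ₜ[K] r' m ∈ D.N →
    ∑ m, t (op (r' m)) * v x * t (op (r m)) = 0

variable {D : Calculus K A Ω} {P : LeftPairing K A Ω X}
  {s : A →ₐ[K] F} {t : Aᵐᵒᵖ →ₐ[K] F} {v : X →ₗ[K] F}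

theorem Relations.map (h : Relations D P s t v) (φ : F →ₐ[K] F') :
    Relations D P (φ.comp s) (φ.comp t) (φ.toLinearMap ∘ₗ v) where
  toTX := h.toTX.map φ
  commute a b := (h.commute a b).map φ
  sum_t_mul_v_mul_t r r' x hr := by simpa using congrArg φ (h.sum_t_mul_v_mul_t r r' x hr)

theorem Relations.of_rel (h : TX.Relations D P s v) {φ : F →ₐ[K] F'}
    (H : ∀ {f g}, SurjBXRel D t s v f g → φ f = φ g) :
    Relations D P (φ.comp s) (φ.comp t) (φ.toLinearMap ∘ₗ v) where
  toTX := h.map φ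
  commute a b := by simpa [commute_iff_eq] using H (.comm a b.unop)
  sum_t_mul_v_mul_t r r' x hr := by simpa using H (.surj r r' x hr)

theorem relations :
    Relations (F := SurjBX D P) D P (SurjBX.s D P) (SurjBX.t D P) (SurjBX.v D P) :=
  .of_rel (TX.relations.map (Coprod.inr K Aᵐᵒᵖ (TX D P))) fun r => RingQuot.mkAlgHom_rel K r

/-- The algebra map out of the second presentation of `B𝔛` given by maps `s`, `t`, `v` which
satisfy its relations. -/
def lift (h : Relations D P s t v) : SurjBX D P →ₐ[K] F :=
  RingQuot.liftAlgHom K ⟨Coprod.lift t (TX.lift h.toTX), fun _ _ r => by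
    cases r with
    | comm a b => simp [(h.commute a (op b)).eq]
    | surj r r' x hr => simp [h.sum_t_mul_v_mul_t _ _ _ hr]⟩

@[simp]
theorem lift_s (h : Relations D P s t v) (a : A) : lift h (SurjBX.s D P a) = s a := by
  simp [lift, SurjBX.s]

@[simp]
theorem lift_t (h : Relations D P s t v) (a : Aᵐᵒᵖ) : lift h (SurjBX.t D P a) = t a := by
  simp [lift, SurjBX.t]

@[simp]
theorem lift_v (h : Relations D P s t v) (x : X) : lift h (SurjBX.v D P x) = v x := by
  simp [lift, SurjBX.v]

theorem algHom_ext {f g : SurjBX D P →ₐ[K] F}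
    (hs : ∀ a, f (SurjBX.s D P a) = g (SurjBX.s D P a))
    (ht : ∀ a, f (SurjBX.t D P a) = g (SurjBX.t D P a))
    (hv : ∀ x, f (SurjBX.v D P x) = g (SurjBX.v D P x)) : f = g :=
  RingQuot.ringQuot_ext' _ _ _ (Coprod.algHom_ext (AlgHom.ext ht) (TX.algHom_ext hs hv))

end SurjBX

namespace SurjIBX

/-- The relations of the second presentation of `IB𝔛` hold for maps `s`, `t`, `v`, `u` on `A`,
`Aᵐᵒᵖ`, `X`, `Y` into an algebra. -/
structure Relations (D : Calculus K A Ω) (P : LeftPairing K A Ω X)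
    (Q : RightPairing K A Ω Y) {k l : ℕ} (b : Fin k → A) (x : Fin k → X) (y : Fin l → Y)
    (c : Fin l → A) (s : A →ₐ[K] F) (t : Aᵐᵒᵖ →ₐ[K] F) (v : X →ₗ[K] F) (u : Y →ₗ[K] F) :
    Prop extends toSurjBX : SurjBX.Relations D P s t v where
  t_mul_u : ∀ a z, t (op a) * u z = u (op a • z)
  u_mul_t : ∀ a z, u z * t (op a) = u (a • z) + t (op (Q.ev (D.d a) z))
  sum_s_mul_u_mul_s : ∀ {n : ℕ} (r r' : Fin n → A) (z : Y), ∑ m, r m ⊗ₜ[K] r' m ∈ D.N →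
    ∑ m, s (r m) * u z * s (r' m) = 0
  sum_lie_u_mul_v : ∀ z, ∑ i, ⁅u z, s (b i)⁆ * v (x i) = u z
  sum_lie_v_mul_u : ∀ z, ∑ j, ⁅v z, t (op (c j))⁆ * u (y j) = v z

variable {D : Calculus K A Ω} {P : LeftPairing K A Ω X}
  {Q : RightPairing K A Ω Y} {k l : ℕ} {b : Fin k → A} {x : Fin k → X} {y : Fin l → Y}
  {c : Fin l → A} {s : A →ₐ[K] F} {t : Aᵐᵒᵖ →ₐ[K] F} {v : X →ₗ[K] F} {u : Y →ₗ[K] F}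

theorem Relations.of_rel (h : SurjBX.Relations D P s t v) {φ : F →ₐ[K] F'}
    (H : ∀ {f g}, SurjIBXRel D Q b x y c t s v u f g → φ f = φ g) :
    Relations D P Q b x y c (φ.comp s) (φ.comp t) (φ.toLinearMap ∘ₗ v) (φ.toLinearMap ∘ₗ u) where
  toSurjBX := h.map φ
  t_mul_u a z := by simpa using H (.left a z)
  u_mul_t a z := by simpa using H (.right a z)
  sum_s_mul_u_mul_s r r' z hr := by simpa using H (.surj r r' z hr)
  sum_lie_u_mul_v z := by simpa [Ring.lie_def] using H (.inv₁ z)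
  sum_lie_v_mul_u z := by simpa [Ring.lie_def] using H (.inv₂ z)

theorem relations : Relations (F := SurjIBX D P Q b x y c) D P Q b x y c
    (SurjIBX.s D P Q b x y c) (SurjIBX.t D P Q b x y c) (SurjIBX.v D P Q b x y c)
    (SurjIBX.u D P Q b x y c) :=
  Relations.of_rel (F := Coprod K (SurjBX D P) (TensorAlgebra K Y)) (F' := SurjIBX D P Q b x y c)
    (φ := RingQuot.mkAlgHom K (SurjIBXr D P Q b x y c))
    (s := (Coprod.inl K _ _).comp (SurjBX.s D P)) (t := (Coprod.inl K _ _).comp (SurjBX.t D P))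
    (v := (Coprod.inl K _ _).toLinearMap ∘ₗ SurjBX.v D P)
    (u := (Coprod.inr K _ _).toLinearMap ∘ₗ TensorAlgebra.ι K)
    (SurjBX.relations.map (Coprod.inl K _ _)) fun r => RingQuot.mkAlgHom_rel K r

/-- The algebra map out of the second presentation of `IB𝔛` given by maps `s`, `t`, `v`, `u`
which satisfy its relations. -/
def lift (h : Relations D P Q b x y c s t v u) : SurjIBX D P Q b x y c →ₐ[K] F :=
  RingQuot.liftAlgHom K
    ⟨Coprod.lift (SurjBX.lift h.toSurjBX) (TensorAlgebra.lift K u), fun _ _ r => by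
      cases r with
      | left a z => simp [h.t_mul_u]
      | right a z => simp [h.u_mul_t]
      | surj r r' z hr => simp [h.sum_s_mul_u_mul_s _ _ _ hr]
      | inv₁ z => simpa [Ring.lie_def] using h.sum_lie_u_mul_v z
      | inv₂ z => simpa [Ring.lie_def] using h.sum_lie_v_mul_u z⟩

section lift

variable (h : Relations D P Q b x y c s t v u)

@[simp]
theorem lift_s (a : A) : lift h (SurjIBX.s D P Q b x y c a) = s a := by
  simp [lift, SurjIBX.s, SurjIBX.ofBX]

@[simp]
theorem lift_t (a : Aᵐᵒᵖ) : lift h (SurjIBX.t D P Q b x y c a) = t a := by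
  simp [lift, SurjIBX.t, SurjIBX.ofBX]

@[simp]
theorem lift_v (z : X) : lift h (SurjIBX.v D P Q b x y c z) = v z := by
  simp [lift, SurjIBX.v, SurjIBX.ofBX]

@[simp]
theorem lift_u (z : Y) : lift h (SurjIBX.u D P Q b x y c z) = u z := by
  simp [lift, SurjIBX.u]

end lift

theorem algHom_ext {f g : SurjIBX D P Q b x y c →ₐ[K] F}
    (hs : ∀ a, f (SurjIBX.s D P Q b x y c a) = g (SurjIBX.s D P Q b x y c a))
    (ht : ∀ a, f (SurjIBX.t D P Q b x y c a) = g (SurjIBX.t D P Q b x y c a))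
    (hv : ∀ z, f (SurjIBX.v D P Q b x y c z) = g (SurjIBX.v D P Q b x y c z))
    (hu : ∀ z, f (SurjIBX.u D P Q b x y c z) = g (SurjIBX.u D P Q b x y c z)) : f = g :=
  RingQuot.ringQuot_ext' _ _ _ (Coprod.algHom_ext (SurjBX.algHom_ext hs ht hv)
    (TensorAlgebra.hom_ext (LinearMap.ext hu)))

end SurjIBX

end UniversalProperties

/-! ### Surjective calculi -/

section Calculus

variable {K A Ω : Type*} [Field K] [Ring A] [Algebra K A]
  [AddCommGroup Ω] [Module K Ω] [Module A Ω] [Module Aᵐᵒᵖ Ω]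

namespace Calculus

variable {D : Calculus K A Ω}

theorem op_smul_d (a b : A) : op b • D.d a = D.d (a * b) - a • D.d b := by
  rw [D.leibniz, add_sub_cancel_left]

theorem sum_smul_d_eq_neg {ι : Type*} {S : Finset ι} {r r' : ι → A}
    (h : ∑ i ∈ S, r i * r' i = 0) :
    ∑ i ∈ S, r i • D.d (r' i) = -∑ i ∈ S, op (r' i) • D.d (r i) := by
  rw [eq_neg_iff_add_eq_zero, ← Finset.sum_add_distrib, ← map_zero D.d, ← h, map_sum]
  exact Finset.sum_congr rfl fun i _ => (D.leibniz _ _).symm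

variable [IsScalarTower K Aᵐᵒᵖ Ω]

@[simp]
theorem fromUniversal_tmul (r r' : A) : D.fromUniversal (r ⊗ₜ r') = op r' • D.d r :=
  rfl

theorem sum_tmul_mem_N {ι : Type*} {S : Finset ι} {r r' : ι → A} :
    ∑ i ∈ S, r i ⊗ₜ[K] r' i ∈ D.N ↔
      ∑ i ∈ S, r i * r' i = 0 ∧ ∑ i ∈ S, op (r' i) • D.d (r i) = 0 := by
  simp [N, universalForms]

namespace IsSurjective

theorem exists_eq_sum_op_smul (hD : D.IsSurjective) (ξ : Ω) :
    ∃ (n : ℕ) (a b : Fin n → A), ξ = ∑ i, op (a i) • D.d (b i) := by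
  obtain ⟨w, -, rfl⟩ := (D.map_fromUniversal hD).ge (Submodule.mem_top (x := ξ))
  obtain ⟨n, b, a, rfl⟩ := TensorProduct.exists_sum_tmul_eq w
  exact ⟨n, a, b, by simp⟩

theorem exists_eq_sum_smul (hD : D.IsSurjective) (ξ : Ω) :
    ∃ (n : ℕ) (a b : Fin n → A), ξ = ∑ i, a i • D.d (b i) := by
  obtain ⟨w, hw, rfl⟩ := (D.map_fromUniversal hD).ge (Submodule.mem_top (x := ξ))
  obtain ⟨n, b, a, rfl⟩ := TensorProduct.exists_sum_tmul_eq w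
  have hba : ∑ i, b i * a i = 0 := by simpa [universalForms] using hw
  exact ⟨n, fun i => -b i, a, by simp [sum_smul_d_eq_neg hba]⟩

theorem induction_on (hD : D.IsSurjective) {C : Ω → Prop} (ξ : Ω) (d : ∀ a, C (D.d a))
    (smul : ∀ (a : A) ξ, C ξ → C (a • ξ)) (add : ∀ ξ η, C ξ → C η → C (ξ + η)) : C ξ := by
  obtain ⟨n, a, b, rfl⟩ := hD.exists_eq_sum_smul ξ
  exact Finset.sum_induction _ C add (map_zero D.d ▸ d 0) fun i _ => smul _ _ (d _)

theorem domRestrict_fromUniversal_surjective (hD : D.IsSurjective) :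
    Function.Surjective (D.fromUniversal.domRestrict (universalForms K A)) := by
  rw [← LinearMap.range_eq_top, LinearMap.range_domRestrict, D.map_fromUniversal hD]

variable {M : Type*} [AddCommGroup M] [Module K M]

/-- The map on `Ω = Ω_uni / 𝒩` induced by a map on `A ⊗ A` which vanishes on `𝒩`. -/
def lift (hD : D.IsSurjective) (G : A ⊗[K] A →ₗ[K] M) (hG : ∀ w ∈ D.N, G w = 0) : Ω →ₗ[K] M :=
  (LinearMap.ker (D.fromUniversal.domRestrict (universalForms K A))).liftQ (G.domRestrict _)
      (fun w hw => hG w ⟨w.2, hw⟩) ∘ₗ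
    (LinearMap.quotKerEquivOfSurjective _ hD.domRestrict_fromUniversal_surjective).symm

variable (hD : D.IsSurjective) (G : A ⊗[K] A →ₗ[K] M) (hG : ∀ w ∈ D.N, G w = 0)

theorem lift_fromUniversal {w : A ⊗[K] A} (hw : w ∈ universalForms K A) :
    hD.lift G hG (D.fromUniversal w) = G w := by
  have h : (LinearMap.quotKerEquivOfSurjective _ hD.domRestrict_fromUniversal_surjective).symm
      (D.fromUniversal w) = Submodule.Quotient.mk ⟨w, hw⟩ :=
    (LinearEquiv.symm_apply_eq _).2 rfl
  rw [lift, LinearMap.comp_apply, LinearEquiv.coe_coe, h]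
  rfl

theorem lift_smul_d (a b : A) :
    hD.lift G hG (a • D.d b) = G ((a * b) ⊗ₜ 1) - G (a ⊗ₜ b) := by
  have hw : (a * b) ⊗ₜ 1 - a ⊗ₜ b ∈ universalForms K A := by simp [universalForms]
  have h := hD.lift_fromUniversal G hG hw
  rwa [map_sub D.fromUniversal, map_sub G, fromUniversal_tmul, fromUniversal_tmul,
    MulOpposite.op_one, one_smul, D.leibniz, add_sub_cancel_right] at h

end IsSurjective

end Calculus

end Calculus

/-! ### Coevaluations -/

section Coevaluations

variable {K A Ω X Y : Type*} [Field K] [Ring A] [Algebra K A]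
  [AddCommGroup Ω] [Module K Ω] [Module A Ω] [Module Aᵐᵒᵖ Ω]
  [AddCommGroup X] [Module K X] [Module A X] [Module Aᵐᵒᵖ X]
  [AddCommGroup Y] [Module K Y] [Module A Y] [Module Aᵐᵒᵖ Y]
  {D : Calculus K A Ω}

/-- A right dual `Y` of `Ω` has `Ω` as its left dual, with the same evaluation. -/
def RightPairing.toLeftPairing (Q : RightPairing K A Ω Y) : LeftPairing K A Y Ω where
  ev := Q.ev
  ev_smul := Q.ev_smul
  ev_balanced := Q.ev_balanced
  ev_op_smul := Q.ev_op_smul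

theorem RightPairing.isCoev_toLeftPairing {Q : RightPairing K A Ω Y} {n : ℕ} {y : Fin n → Y}
    {ρ : Fin n → Ω} : Q.toLeftPairing.IsCoev y ρ ↔ Q.IsCoev y ρ :=
  and_comm

namespace LeftPairing.IsCoev

variable {P : LeftPairing K A Ω X} {n m : ℕ} {ω : Fin n → Ω} {x : Fin n → X} {ω' : Fin m → Ω}
  {x' : Fin m → X}

/-- With `S = T = id` this says that the coevaluation is unique, and with `S = (a • ·)`,
`T = (op a • ·)` that it is central. -/
theorem sum_map_eq {M : Type*} [AddCommGroup M] [Module K M] (h : P.IsCoev ω x)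
    (h' : P.IsCoev ω' x') (f : Ω →ₗ[K] X →ₗ[K] M) (hf : ∀ (a : A) ξ z, f (op a • ξ) z = f ξ (a • z))
    {S : Ω → Ω} {T : X → X} (hST : ∀ z ξ, P.ev z (S ξ) = P.ev (T z) ξ) :
    ∑ i, f (S (ω i)) (x i) = ∑ j, f (ω' j) (T (x' j)) := by
  calc ∑ i, f (S (ω i)) (x i)
      = ∑ i, f (∑ j, op (P.ev (x' j) (S (ω i))) • ω' j) (x i) := by simp only [h'.1]
    _ = ∑ i, ∑ j, f (ω' j) (P.ev (T (x' j)) (ω i) • x i) := by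
        simp only [map_sum, LinearMap.sum_apply, hf, hST]
    _ = ∑ j, f (ω' j) (∑ i, P.ev (T (x' j)) (ω i) • x i) := by
        rw [Finset.sum_comm]
        simp only [map_sum]
    _ = ∑ j, f (ω' j) (T (x' j)) := by simp only [h.2]

theorem refine_left (h : P.IsCoev ω x) {N : Fin n → ℕ} (a : ∀ i, Fin (N i) → A)
    (η : ∀ i, Fin (N i) → Ω) (hω : ∀ i, ω i = ∑ j, op (a i j) • η i j) :
    P.IsCoev (fun k => η (finSigmaFinEquiv.symm k).1 (finSigmaFinEquiv.symm k).2)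
      (fun k => a (finSigmaFinEquiv.symm k).1 (finSigmaFinEquiv.symm k).2 •
        x (finSigmaFinEquiv.symm k).1) := by
  constructor
  · refine fun ξ => Eq.trans ?_ (h.1 ξ)
    rw [finSigmaFinEquiv.symm.sum_comp fun k => op (P.ev (a k.1 k.2 • x k.1) ξ) • η k.1 k.2,
      Fintype.sum_sigma]
    simp only [hω, P.ev_smul, MulOpposite.op_mul, mul_smul, Finset.smul_sum]
  · refine fun z => Eq.trans ?_ (h.2 z)
    rw [finSigmaFinEquiv.symm.sum_comp fun k => P.ev z (η k.1 k.2) • a k.1 k.2 • x k.1,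
      Fintype.sum_sigma]
    simp only [hω, map_sum, P.ev_op_smul, Finset.sum_smul, mul_smul]

theorem refine_right (h : P.IsCoev ω x) {N : Fin n → ℕ} (a : ∀ i, Fin (N i) → A)
    (θ : ∀ i, Fin (N i) → X) (hx : ∀ i, x i = ∑ j, a i j • θ i j) :
    P.IsCoev (fun k => op (a (finSigmaFinEquiv.symm k).1 (finSigmaFinEquiv.symm k).2) •
        ω (finSigmaFinEquiv.symm k).1)
      (fun k => θ (finSigmaFinEquiv.symm k).1 (finSigmaFinEquiv.symm k).2) := by
  constructor
  · refine fun ξ => Eq.trans ?_ (h.1 ξ)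
    rw [finSigmaFinEquiv.symm.sum_comp fun k => op (P.ev (θ k.1 k.2) ξ) • op (a k.1 k.2) • ω k.1,
      Fintype.sum_sigma]
    simp only [hx, map_sum, LinearMap.sum_apply, P.ev_smul, MulOpposite.op_mul, mul_smul,
      Finset.op_sum, Finset.sum_smul]
  · refine fun z => Eq.trans ?_ (h.2 z)
    rw [finSigmaFinEquiv.symm.sum_comp fun k => P.ev z (op (a k.1 k.2) • ω k.1) • θ k.1 k.2,
      Fintype.sum_sigma]
    simp only [hx, P.ev_op_smul, Finset.smul_sum, mul_smul]

theorem exists_d [IsScalarTower K Aᵐᵒᵖ Ω] (h : P.IsCoev ω x) (hD : D.IsSurjective) :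
    ∃ (k : ℕ) (b : Fin k → A) (x' : Fin k → X), P.IsCoev (fun i => D.d (b i)) x' := by
  choose N a b hab using fun i => hD.exists_eq_sum_op_smul (ω i)
  exact ⟨_, _, _, h.refine_left a (fun i j => D.d (b i j)) hab⟩

end LeftPairing.IsCoev

theorem RightPairing.IsCoev.exists_d [IsScalarTower K Aᵐᵒᵖ Ω] {Q : RightPairing K A Ω Y} {n : ℕ}
    {y : Fin n → Y} {ρ : Fin n → Ω} (h : Q.IsCoev y ρ) (hD : D.IsSurjective) :
    ∃ (l : ℕ) (y' : Fin l → Y) (c : Fin l → A), Q.IsCoev y' (fun j => D.d (c j)) := by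
  choose N a c hac using fun j => hD.exists_eq_sum_smul (ρ j)
  exact ⟨_, _, _, isCoev_toLeftPairing.1 <|
    (isCoev_toLeftPairing.2 h).refine_right a (fun i j => D.d (c i j)) hac⟩

end Coevaluations

/-! ### Commutators -/

section Commutators

variable {R : Type*} [Ring R]

theorem lie_mul (w x y : R) : ⁅w, x * y⁆ = ⁅w, x⁆ * y + x * ⁅w, y⁆ := by
  simp only [Ring.lie_def]
  noncomm_ring

theorem add_lie_of_commute {x y : R} (h : Commute x y) (w : R) : ⁅w + x, y⁆ = ⁅w, y⁆ := by
  rw [Ring.lie_def, Ring.lie_def, add_mul, mul_add, h.eq, add_sub_add_right_eq_sub]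

theorem mul_lie_of_commute {x y : R} (h : Commute x y) (w : R) : ⁅x * w, y⁆ = x * ⁅w, y⁆ := by
  rw [Ring.lie_def, Ring.lie_def, mul_sub, mul_assoc, ← mul_assoc y, ← h.eq, mul_assoc]

theorem mul_lie_of_commute_right {x y : R} (h : Commute x y) (w : R) :
    ⁅w * x, y⁆ = ⁅w, y⁆ * x := by
  rw [Ring.lie_def, Ring.lie_def, sub_mul, mul_assoc, h.eq, mul_assoc, mul_assoc]

end Commutators

section Sandwich

variable {K M N W F : Type*} [CommRing K] [AddCommGroup M] [Module K M] [AddCommGroup N]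
  [Module K N] [AddCommGroup W] [Module K W] [Ring F] [Algebra K F]

/-- The map `r ⊗ r' ↦ α r * w · * β r'`, whose vanishing on `𝒩` is one of the relations of the
second presentations. -/
def sandwich (α : M →ₗ[K] F) (β : N →ₗ[K] F) (w : W →ₗ[K] F) : M ⊗[K] N →ₗ[K] W →ₗ[K] F :=
  TensorProduct.lift (LinearMap.mk₂ K (fun r r' => LinearMap.mulLeftRight K (α r, β r') ∘ₗ w)
    (fun _ _ _ => by ext; simp [add_mul]) (fun _ _ _ => by ext; simp)
    (fun _ _ _ => by ext; simp [mul_add]) (fun _ _ _ => by ext; simp))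

@[simp]
theorem sandwich_tmul (α : M →ₗ[K] F) (β : N →ₗ[K] F) (w : W →ₗ[K] F) (r : M) (r' : N) (z : W) :
    sandwich α β w (r ⊗ₜ r') z = α r * w z * β r' := by
  simp [sandwich]

end Sandwich

/-! ### The two presentations of `B𝔛` -/

section ComparisonBX

variable {K A Ω X F : Type*} [Field K] [Ring A] [Algebra K A]
  [AddCommGroup Ω] [Module K Ω] [Module A Ω] [Module Aᵐᵒᵖ Ω]
  [AddCommGroup X] [Module K X] [Module A X] [Module Aᵐᵒᵖ X]
  [Ring F] [Algebra K F]
  {D : Calculus K A Ω} {P : LeftPairing K A Ω X}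
  {s : A →ₐ[K] F} {t : Aᵐᵒᵖ →ₐ[K] F} {v : X →ₗ[K] F}

namespace BX.Relations

variable {p : X ⊗[K] Ω →ₗ[K] F}

theorem lie_v_t (h : Relations D P s t v p) (x : X) (a : A) :
    ⁅v x, t (op a)⁆ = p (x ⊗ₜ D.d a) := by
  rw [Ring.lie_def, h.v_mul_t, add_sub_cancel_left]

theorem t_mul_v_mul_t (h : Relations D P s t v p) (x : X) (r r' : A) :
    t (op r') * v x * t (op r) =
      t (op (r * r')) * v x + p (x ⊗ₜ (op r' • D.d r)) := by
  rw [mul_assoc, h.v_mul_t, mul_add, h.t_mul_p, ← mul_assoc, ← map_mul, MulOpposite.op_mul]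

variable [IsScalarTower K Aᵐᵒᵖ Ω]

theorem map_p_eq {F' : Type*} [Ring F'] [Algebra K F'] (h : Relations D P s t v p)
    (hD : D.IsSurjective) {f g : F →ₐ[K] F'} (ht : ∀ a, f (t a) = g (t a))
    (hv : ∀ x, f (v x) = g (v x)) (x : X) (ξ : Ω) : f (p (x ⊗ₜ ξ)) = g (p (x ⊗ₜ ξ)) := by
  induction ξ using hD.induction_on with
  | d a => simp only [← h.lie_v_t, Ring.lie_def, map_sub, map_mul, ht, hv]
  | smul a ξ ih => rw [← h.p_mul_t, map_mul, map_mul, ih, ht]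
  | add ξ η hξ hη => simp only [TensorProduct.tmul_add, map_add, hξ, hη]

theorem toSurjBX (h : Relations D P s t v p) : SurjBX.Relations D P s t v where
  toTX := h.toTX
  commute := h.commute
  sum_t_mul_v_mul_t r r' x hr := by
    rw [Calculus.sum_tmul_mem_N] at hr
    simp only [h.t_mul_v_mul_t, Finset.sum_add_distrib, ← Finset.sum_mul, ← map_sum,
      ← Finset.op_sum, ← TensorProduct.tmul_sum, hr.1, hr.2, MulOpposite.op_zero, map_zero,
      zero_mul, TensorProduct.tmul_zero, add_zero]

end BX.Relations

variable [IsScalarTower K Aᵐᵒᵖ Ω]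

namespace SurjBX.Relations

theorem s_mul_lie_v (h : Relations D P s t v) (a : A) (x : X) (b : Aᵐᵒᵖ) :
    s a * ⁅v x, t b⁆ = ⁅v (a • x), t b⁆ := by
  rw [← mul_lie_of_commute (h.commute a b), h.s_mul_v]

theorem lie_v_mul_s (h : Relations D P s t v) (a : A) (x : X) (b : Aᵐᵒᵖ) :
    ⁅v x, t b⁆ * s a = ⁅v (op a • x), t b⁆ := by
  rw [← mul_lie_of_commute_right (h.commute a b), h.v_mul_s,
    add_lie_of_commute (h.commute _ b)]

/-- The map on `X ⊗ Ω` which makes `s`, `t`, `v` satisfy the relations of the first presentation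
of `B𝔛`, characterised by `p (x ⊗ a db) = ⁅v x, t b⁆ * t a`. -/
def p (h : Relations D P s t v) (hD : D.IsSurjective) : X ⊗[K] Ω →ₗ[K] F :=
  let τ : A →ₗ[K] F := t.toLinearMap ∘ₗ (MulOpposite.opLinearEquiv K).toLinearMap
  TensorProduct.lift (hD.lift (sandwich τ τ v ∘ₗ (TensorProduct.comm K A A).toLinearMap)
    fun w hw => by
      obtain ⟨n, r, r', rfl⟩ := TensorProduct.exists_sum_tmul_eq w
      ext x
      simpa [τ] using h.sum_t_mul_v_mul_t r r' x hw).flip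

variable (h : Relations D P s t v) (hD : D.IsSurjective)

theorem p_tmul_smul_d (x : X) (a b : A) :
    h.p hD (x ⊗ₜ (a • D.d b)) = ⁅v x, t (op b)⁆ * t (op a) := by
  simp [p, Calculus.IsSurjective.lift_smul_d, Ring.lie_def, sub_mul, mul_assoc]

theorem p_tmul_d (x : X) (a : A) : h.p hD (x ⊗ₜ D.d a) = ⁅v x, t (op a)⁆ := by
  simpa using h.p_tmul_smul_d hD x 1 a

theorem p_mul_t (a : A) (x : X) (ξ : Ω) :
    h.p hD (x ⊗ₜ ξ) * t (op a) = h.p hD (x ⊗ₜ (a • ξ)) := by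
  induction ξ using hD.induction_on generalizing a with
  | d b => rw [p_tmul_d, p_tmul_smul_d]
  | smul g ξ ih => rw [← ih, mul_assoc, ← map_mul, ← MulOpposite.op_mul, ih, mul_smul]
  | add ξ η hξ hη => simp only [TensorProduct.tmul_add, smul_add, map_add, add_mul, hξ, hη]

theorem s_mul_p (a : A) (x : X) (ξ : Ω) :
    s a * h.p hD (x ⊗ₜ ξ) = h.p hD ((a • x) ⊗ₜ ξ) := by
  induction ξ using hD.induction_on with
  | d b => rw [p_tmul_d, p_tmul_d, h.s_mul_lie_v]
  | smul g ξ ih => rw [← p_mul_t, ← p_mul_t, ← mul_assoc, ih]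
  | add ξ η hξ hη => simp only [TensorProduct.tmul_add, map_add, mul_add, hξ, hη]

theorem p_mul_s (a : A) (x : X) (ξ : Ω) :
    h.p hD (x ⊗ₜ ξ) * s a = h.p hD ((op a • x) ⊗ₜ ξ) := by
  induction ξ using hD.induction_on with
  | d b => rw [p_tmul_d, p_tmul_d, h.lie_v_mul_s]
  | smul g ξ ih => rw [← p_mul_t, ← p_mul_t, mul_assoc, ← (h.commute _ _).eq, ← mul_assoc, ih]
  | add ξ η hξ hη => simp only [TensorProduct.tmul_add, map_add, add_mul, hξ, hη]

theorem t_mul_p [SMulCommClass A Aᵐᵒᵖ Ω] (a : A) (x : X) (ξ : Ω) :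
    t (op a) * h.p hD (x ⊗ₜ ξ) = h.p hD (x ⊗ₜ (op a • ξ)) := by
  induction ξ using hD.induction_on with
  | d b =>
    rw [Calculus.op_smul_d, TensorProduct.tmul_sub, map_sub, p_tmul_d, p_tmul_d, p_tmul_smul_d,
      MulOpposite.op_mul, map_mul, lie_mul, add_sub_cancel_left]
  | smul g ξ ih => rw [← smul_comm, ← p_mul_t, ← p_mul_t, ← mul_assoc, ih]
  | add ξ η hξ hη => simp only [TensorProduct.tmul_add, smul_add, map_add, mul_add, hξ, hη]

theorem toBX [SMulCommClass A Aᵐᵒᵖ Ω] : BX.Relations D P s t v (h.p hD) where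
  toTX := h.toTX
  commute := h.commute
  v_mul_t a x := by rw [p_tmul_d, Ring.lie_def, add_sub_cancel]
  s_mul_p := h.s_mul_p hD
  t_mul_p := h.t_mul_p hD
  p_mul_s := h.p_mul_s hD
  p_mul_t := h.p_mul_t hD

end SurjBX.Relations

namespace BX

variable [SMulCommClass A Aᵐᵒᵖ Ω] (P) (hD : D.IsSurjective)

/-- The two presentations of `B𝔛` define the same algebra. -/
def equivSurjBX : BX D P ≃ₐ[K] SurjBX D P :=
  AlgEquiv.ofAlgHom (BX.lift (SurjBX.relations.toBX hD)) (SurjBX.lift BX.relations.toSurjBX)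
    (SurjBX.algHom_ext (F := SurjBX D P) (by simp) (by simp) (by simp))
    (BX.algHom_ext (F := BX D P) (by simp) (by simp) (by simp)
      (BX.relations.map_p_eq (F' := BX D P) hD (by simp) (by simp)))

theorem equivSurjBX_e (a : A) (a' : Aᵐᵒᵖ) :
    equivSurjBX P hD (BX.e D P (a ⊗ₜ a')) = SurjBX.s D P a * SurjBX.t D P a' :=
  BX.lift_e _ a a'

theorem equivSurjBX_v (x : X) : equivSurjBX P hD (BX.v D P x) = SurjBX.v D P x :=
  BX.lift_v _ x

theorem equivSurjBX_p (x : X) (a b : A) :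
    equivSurjBX P hD (BX.p D P (x ⊗ₜ (a • D.d b))) =
      ⁅SurjBX.v D P x, SurjBX.t D P (op b)⁆ * SurjBX.t D P (op a) :=
  (BX.lift_p _ _).trans (SurjBX.relations.p_tmul_smul_d hD x a b)

end BX

end ComparisonBX

/-! ### The two presentations of `IB𝔛` -/

section ComparisonIBX

variable {K A Ω X Y F : Type*} [Field K] [Ring A] [Algebra K A]
  [AddCommGroup Ω] [Module K Ω] [Module A Ω] [Module Aᵐᵒᵖ Ω]
  [AddCommGroup X] [Module K X] [Module A X] [Module Aᵐᵒᵖ X]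
  [AddCommGroup Y] [Module K Y] [Module A Y] [Module Aᵐᵒᵖ Y]
  [Ring F] [Algebra K F]
  {D : Calculus K A Ω} {P : LeftPairing K A Ω X} {Q : RightPairing K A Ω Y}
  {n m k l : ℕ} {s : A →ₐ[K] F} {t : Aᵐᵒᵖ →ₐ[K] F} {v : X →ₗ[K] F}

namespace IBX

/-- The map `z ↦ ∑ i, q (ω i ⊗ z) * v (x i)` on `Y`, which plays the role of `u` in the second
presentation of `IB𝔛`. -/
def bar (ω : Fin n → Ω) (x : Fin n → X) (v : X →ₗ[K] F) (q : Ω ⊗[K] Y →ₗ[K] F) : Y →ₗ[K] F :=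
  ∑ i, LinearMap.mulRight K (v (x i)) ∘ₗ q ∘ₗ TensorProduct.mk K Ω Y (ω i)

@[simp]
theorem bar_apply (ω : Fin n → Ω) (x : Fin n → X) (v : X →ₗ[K] F) (q : Ω ⊗[K] Y →ₗ[K] F)
    (z : Y) : bar ω x v q z = ∑ i, q (ω i ⊗ₜ z) * v (x i) := by
  simp [bar]

namespace Relations

variable {ω : Fin n → Ω} {x : Fin n → X} {y : Fin m → Y} {ρ : Fin m → Ω}
  {p : X ⊗[K] Ω →ₗ[K] F} {q : Ω ⊗[K] Y →ₗ[K] F}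

theorem congr_coev (h : Relations D P Q ω x y ρ s t v p q) (hP : P.IsCoev ω x)
    (hQ : Q.IsCoev y ρ) {ω' : Fin k → Ω} {x' : Fin k → X} {y' : Fin l → Y} {ρ' : Fin l → Ω}
    (hP' : P.IsCoev ω' x') (hQ' : Q.IsCoev y' ρ') : Relations D P Q ω' x' y' ρ' s t v p q where
  toBX := h.toBX
  s_mul_q := h.s_mul_q
  t_mul_q := h.t_mul_q
  q_mul_s := h.q_mul_s
  q_mul_t := h.q_mul_t
  sum_q_mul_p ξ z := by
    rw [← h.sum_q_mul_p]
    exact hP'.sum_map_eq hP (S := id) (T := id)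
      ((LinearMap.mul K F).compl₁₂ (q ∘ₗ (TensorProduct.mk K Ω Y).flip z)
        (p ∘ₗ (TensorProduct.mk K X Ω).flip ξ))
      (by simp [← h.q_mul_s, ← h.s_mul_p, mul_assoc]) (fun _ _ => rfl)
  sum_p_mul_q z ξ := by
    rw [← h.sum_p_mul_q]
    exact (RightPairing.isCoev_toLeftPairing.2 hQ').sum_map_eq
      (RightPairing.isCoev_toLeftPairing.2 hQ) (S := id) (T := id)
      ((LinearMap.mul K F).flip.compl₁₂ (q ∘ₗ TensorProduct.mk K Ω Y ξ)
        (p ∘ₗ TensorProduct.mk K X Ω z))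
      (by simp [← h.t_mul_q, ← h.p_mul_t, mul_assoc]) (fun _ _ => rfl)

theorem s_mul_bar (h : Relations D P Q ω x y ρ s t v p q) (hP : P.IsCoev ω x) (a : A) (z : Y) :
    s a * bar ω x v q z = ∑ i, q (ω i ⊗ₜ z) * v (op a • x i) := by
  simp only [bar_apply, Finset.mul_sum, ← mul_assoc, h.s_mul_q]
  exact hP.sum_map_eq hP (S := (a • ·)) (T := (op a • ·))
    ((LinearMap.mul K F).compl₁₂ (q ∘ₗ (TensorProduct.mk K Ω Y).flip z) v)
    (by simp [← h.q_mul_s, ← h.s_mul_v, mul_assoc]) fun w ξ => (P.ev_balanced a w ξ).symm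

theorem bar_mul_s (h : Relations D P Q ω x y ρ s t v p q) (hP : P.IsCoev ω x) (a : A) (z : Y) :
    bar ω x v q z * s a = s a * bar ω x v q z + q (D.d a ⊗ₜ z) := by
  calc bar ω x v q z * s a
      = ∑ i, q (ω i ⊗ₜ z) * v (op a • x i) + q ((∑ i, op (P.ev (x i) (D.d a)) • ω i) ⊗ₜ z) := by
        simp only [bar_apply, Finset.sum_mul, mul_assoc, h.v_mul_s, mul_add, h.q_mul_s,
          Finset.sum_add_distrib, TensorProduct.sum_tmul, map_sum]
    _ = s a * bar ω x v q z + q (D.d a ⊗ₜ z) := by rw [h.s_mul_bar hP, hP.1]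

theorem lie_bar_s (h : Relations D P Q ω x y ρ s t v p q) (hP : P.IsCoev ω x) (a : A) (z : Y) :
    ⁅bar ω x v q z, s a⁆ = q (D.d a ⊗ₜ z) := by
  rw [Ring.lie_def, h.bar_mul_s hP, add_sub_cancel_left]

theorem bar_mul_t (h : Relations D P Q ω x y ρ s t v p q) (a : A) (z : Y) :
    bar ω x v q z * t (op a) = bar ω x v q (a • z) + t (op (Q.ev (D.d a) z)) := by
  simp only [bar_apply, Finset.sum_mul, mul_assoc, h.v_mul_t, mul_add, Finset.sum_add_distrib,
    h.sum_q_mul_p]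
  simp only [← mul_assoc, h.q_mul_t]

theorem sum_lie_v_mul_bar {c : Fin m → A}
    (h : Relations D P Q ω x y (fun j => D.d (c j)) s t v p q) (hP : P.IsCoev ω x) (z : X) :
    ∑ j, ⁅v z, t (op (c j))⁆ * bar ω x v q (y j) = v z := by
  calc ∑ j, ⁅v z, t (op (c j))⁆ * bar ω x v q (y j)
      = ∑ i, (∑ j, p (z ⊗ₜ D.d (c j)) * q (ω i ⊗ₜ y j)) * v (x i) := by
        simp only [h.lie_v_t, bar_apply, Finset.mul_sum, Finset.sum_mul, mul_assoc]
        exact Finset.sum_comm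
    _ = v (∑ i, P.ev z (ω i) • x i) := by simp only [h.sum_p_mul_q, h.s_mul_v, map_sum]
    _ = v z := by rw [hP.2]

variable [IsScalarTower K Aᵐᵒᵖ Ω]

theorem map_q_eq {F' : Type*} [Ring F'] [Algebra K F'] (h : Relations D P Q ω x y ρ s t v p q)
    (hP : P.IsCoev ω x) (hD : D.IsSurjective) {f g : F →ₐ[K] F'} (hs : ∀ a, f (s a) = g (s a))
    (hbar : ∀ z, f (bar ω x v q z) = g (bar ω x v q z)) (ξ : Ω) (z : Y) :
    f (q (ξ ⊗ₜ z)) = g (q (ξ ⊗ₜ z)) := by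
  induction ξ using hD.induction_on with
  | d a => simp only [← h.lie_bar_s hP, Ring.lie_def, map_sub, map_mul, hs, hbar]
  | smul a ξ ih => rw [← h.s_mul_q, map_mul, map_mul, ih, hs]
  | add ξ η hξ hη => simp only [TensorProduct.add_tmul, map_add, hξ, hη]

theorem sum_s_mul_bar_mul_s (h : Relations D P Q ω x y ρ s t v p q) (hP : P.IsCoev ω x)
    (r r' : Fin k → A) (z : Y) (hr : ∑ i, r i ⊗ₜ[K] r' i ∈ D.N) :
    ∑ i, s (r i) * bar ω x v q z * s (r' i) = 0 := by
  obtain ⟨hmul, hd⟩ := Calculus.sum_tmul_mem_N.1 hr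
  calc ∑ i, s (r i) * bar ω x v q z * s (r' i)
      = s (∑ i, r i * r' i) * bar ω x v q z + q ((∑ i, r i • D.d (r' i)) ⊗ₜ z) := by
        simp only [mul_assoc, h.bar_mul_s hP, mul_add, h.s_mul_q, Finset.sum_add_distrib, map_sum,
          map_mul, Finset.sum_mul, TensorProduct.sum_tmul]
    _ = 0 := by simp [hmul, Calculus.sum_smul_d_eq_neg hmul, hd]

theorem toSurjIBX {b : Fin n → A} {c : Fin m → A}
    (h : Relations D P Q (fun i => D.d (b i)) x y (fun j => D.d (c j)) s t v p q)
    (hP : P.IsCoev (fun i => D.d (b i)) x) :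
    SurjIBX.Relations D P Q b x y c s t v (bar (fun i => D.d (b i)) x v q) where
  toSurjBX := h.toBX.toSurjBX
  t_mul_u a z := by simp only [bar_apply, Finset.mul_sum, ← mul_assoc, h.t_mul_q]
  u_mul_t := h.bar_mul_t
  sum_s_mul_u_mul_s := h.sum_s_mul_bar_mul_s hP
  sum_lie_u_mul_v z := by simp only [h.lie_bar_s hP, ← bar_apply]
  sum_lie_v_mul_u := h.sum_lie_v_mul_bar hP

end Relations

end IBX

variable [IsScalarTower K Aᵐᵒᵖ Ω] {b : Fin k → A} {x : Fin k → X} {y : Fin l → Y} {c : Fin l → A}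

namespace SurjIBX.Relations

variable {u : Y →ₗ[K] F}

theorem t_mul_lie_u (h : Relations D P Q b x y c s t v u) (a b' : A) (z : Y) :
    t (op a) * ⁅u z, s b'⁆ = ⁅u (op a • z), s b'⁆ := by
  rw [← mul_lie_of_commute (h.commute b' (op a)).symm, h.t_mul_u]

theorem lie_u_mul_t (h : Relations D P Q b x y c s t v u) (a b' : A) (z : Y) :
    ⁅u z, s b'⁆ * t (op a) = ⁅u (a • z), s b'⁆ := by
  rw [← mul_lie_of_commute_right (h.commute b' (op a)).symm, h.u_mul_t,
    add_lie_of_commute (h.commute b' _).symm]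

/-- The map on `Ω ⊗ Y` which makes `s`, `t`, `v` satisfy the relations of the first presentation
of `IB𝔛`, characterised by `q (a db ⊗ z) = s a * ⁅u z, s b⁆`. -/
def q (h : Relations D P Q b x y c s t v u) (hD : D.IsSurjective) : Ω ⊗[K] Y →ₗ[K] F :=
  TensorProduct.lift (hD.lift (-sandwich s.toLinearMap s.toLinearMap u) fun w hw => by
    obtain ⟨n, r, r', rfl⟩ := TensorProduct.exists_sum_tmul_eq w
    ext z
    simpa using h.sum_s_mul_u_mul_s r r' z hw)

variable (h : Relations D P Q b x y c s t v u) (hD : D.IsSurjective)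

theorem q_smul_d_tmul (a b' : A) (z : Y) :
    h.q hD ((a • D.d b') ⊗ₜ z) = s a * ⁅u z, s b'⁆ := by
  simp [q, Calculus.IsSurjective.lift_smul_d, Ring.lie_def, mul_sub, mul_assoc, neg_add_eq_sub]

theorem q_d_tmul (a : A) (z : Y) : h.q hD (D.d a ⊗ₜ z) = ⁅u z, s a⁆ := by
  simpa using h.q_smul_d_tmul hD 1 a z

theorem s_mul_q (a : A) (ξ : Ω) (z : Y) :
    s a * h.q hD (ξ ⊗ₜ z) = h.q hD ((a • ξ) ⊗ₜ z) := by
  induction ξ using hD.induction_on generalizing a with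
  | d b' => rw [q_d_tmul, q_smul_d_tmul]
  | smul g ξ ih => rw [← ih, ← mul_assoc, ← map_mul, ih, mul_smul]
  | add ξ η hξ hη => simp only [TensorProduct.add_tmul, smul_add, map_add, mul_add, hξ, hη]

theorem t_mul_q (a : A) (ξ : Ω) (z : Y) :
    t (op a) * h.q hD (ξ ⊗ₜ z) = h.q hD (ξ ⊗ₜ (op a • z)) := by
  induction ξ using hD.induction_on with
  | d b' => rw [q_d_tmul, q_d_tmul, h.t_mul_lie_u]
  | smul g ξ ih => rw [← s_mul_q, ← s_mul_q, ← mul_assoc, ← (h.commute _ _).eq, mul_assoc, ih]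
  | add ξ η hξ hη => simp only [TensorProduct.add_tmul, map_add, mul_add, hξ, hη]

theorem q_mul_t (a : A) (ξ : Ω) (z : Y) :
    h.q hD (ξ ⊗ₜ z) * t (op a) = h.q hD (ξ ⊗ₜ (a • z)) := by
  induction ξ using hD.induction_on with
  | d b' => rw [q_d_tmul, q_d_tmul, h.lie_u_mul_t]
  | smul g ξ ih => rw [← s_mul_q, ← s_mul_q, mul_assoc, ih]
  | add ξ η hξ hη => simp only [TensorProduct.add_tmul, map_add, add_mul, hξ, hη]

theorem q_mul_s [SMulCommClass A Aᵐᵒᵖ Ω] (a : A) (ξ : Ω) (z : Y) :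
    h.q hD (ξ ⊗ₜ z) * s a = h.q hD ((op a • ξ) ⊗ₜ z) := by
  induction ξ using hD.induction_on with
  | d b' =>
    rw [Calculus.op_smul_d, TensorProduct.sub_tmul, map_sub, q_d_tmul, q_d_tmul, q_smul_d_tmul,
      map_mul, lie_mul, add_sub_cancel_right]
  | smul g ξ ih => rw [← smul_comm, ← s_mul_q, ← s_mul_q, mul_assoc, ih]
  | add ξ η hξ hη => simp only [TensorProduct.add_tmul, smul_add, map_add, add_mul, hξ, hη]

theorem sum_q_mul_p (ξ : Ω) (z : Y) :
    ∑ i, h.q hD (D.d (b i) ⊗ₜ z) * h.toSurjBX.p hD (x i ⊗ₜ ξ) = t (op (Q.ev ξ z)) := by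
  induction ξ using hD.induction_on with
  | d a =>
    calc ∑ i, h.q hD (D.d (b i) ⊗ₜ z) * h.toSurjBX.p hD (x i ⊗ₜ D.d a)
        = (∑ i, ⁅u z, s (b i)⁆ * v (x i)) * t (op a) -
            ∑ i, ⁅u z, s (b i)⁆ * t (op a) * v (x i) := by
          simp only [q_d_tmul, SurjBX.Relations.p_tmul_d, Ring.lie_def (v _), mul_sub,
            Finset.sum_sub_distrib, Finset.sum_mul, mul_assoc]
      _ = t (op (Q.ev (D.d a) z)) := by
          simp only [h.lie_u_mul_t, h.sum_lie_u_mul_v, h.u_mul_t, add_sub_cancel_left]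
  | smul a ξ ih =>
    simp only [← SurjBX.Relations.p_mul_t, ← mul_assoc, ← Finset.sum_mul, ih, Q.ev_smul,
      MulOpposite.op_mul, map_mul]
  | add ξ η hξ hη =>
    simp only [TensorProduct.tmul_add, map_add, mul_add, Finset.sum_add_distrib, hξ, hη,
      LinearMap.add_apply, MulOpposite.op_add]

theorem sum_p_mul_q (z : X) (ξ : Ω) :
    ∑ j, h.toSurjBX.p hD (z ⊗ₜ D.d (c j)) * h.q hD (ξ ⊗ₜ y j) = s (P.ev z ξ) := by
  induction ξ using hD.induction_on generalizing z with
  | d a =>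
    calc ∑ j, h.toSurjBX.p hD (z ⊗ₜ D.d (c j)) * h.q hD (D.d a ⊗ₜ y j)
        = (∑ j, ⁅v z, t (op (c j))⁆ * u (y j)) * s a -
            ∑ j, ⁅v z, t (op (c j))⁆ * s a * u (y j) := by
          simp only [q_d_tmul, SurjBX.Relations.p_tmul_d, Ring.lie_def (u _), mul_sub,
            Finset.sum_sub_distrib, Finset.sum_mul, mul_assoc]
      _ = s (P.ev z (D.d a)) := by
          simp only [h.toSurjBX.lie_v_mul_s, h.sum_lie_v_mul_u, h.v_mul_s, add_sub_cancel_left]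
  | smul a ξ ih =>
    simp only [← s_mul_q, ← mul_assoc, SurjBX.Relations.p_mul_s, ih, P.ev_balanced]
  | add ξ η hξ hη =>
    simp only [TensorProduct.add_tmul, map_add, mul_add, Finset.sum_add_distrib, hξ, hη]

theorem toIBX [SMulCommClass A Aᵐᵒᵖ Ω] :
    IBX.Relations D P Q (fun i => D.d (b i)) x y (fun j => D.d (c j)) s t v (h.toSurjBX.p hD)
      (h.q hD) where
  toBX := h.toSurjBX.toBX hD
  s_mul_q := h.s_mul_q hD
  t_mul_q := h.t_mul_q hD
  q_mul_s := h.q_mul_s hD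
  q_mul_t := h.q_mul_t hD
  sum_q_mul_p := h.sum_q_mul_p hD
  sum_p_mul_q := h.sum_p_mul_q hD

end SurjIBX.Relations

namespace IBX

variable [SMulCommClass A Aᵐᵒᵖ Ω] {ω : Fin n → Ω} {x₀ : Fin n → X} {y₀ : Fin m → Y}
  {ρ : Fin m → Ω} (hD : D.IsSurjective) (hP : P.IsCoev ω x₀) (hQ : Q.IsCoev y₀ ρ)
  (hP' : P.IsCoev (fun i => D.d (b i)) x) (hQ' : Q.IsCoev y (fun j => D.d (c j)))

/-- The two presentations of `IB𝔛`, which may use different expressions of the coevaluations,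
define the same algebra. -/
def equivSurjIBX : IBX D P Q ω x₀ y₀ ρ ≃ₐ[K] SurjIBX D P Q b x y c :=
  let h := SurjIBX.relations.toIBX hD
  let h' := IBX.relations.congr_coev hP hQ hP' hQ'
  let f := IBX.lift (h.congr_coev hP' hQ' hP hQ)
  let g := SurjIBX.lift (h'.toSurjIBX hP')
  have hbar (z : Y) : f (bar (fun i => D.d (b i)) x _ _ z) = SurjIBX.u D P Q b x y c z := by
    simp [f, SurjIBX.Relations.q_d_tmul, SurjIBX.relations.sum_lie_u_mul_v]
  AlgEquiv.ofAlgHom f g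
    (SurjIBX.algHom_ext (F := SurjIBX D P Q b x y c) (by simp [f, g]) (by simp [f, g])
      (by simp [f, g]) fun z => (congrArg f (SurjIBX.lift_u _ z)).trans (hbar z))
    (IBX.algHom_ext (F := IBX D P Q ω x₀ y₀ ρ) (by simp [f, g]) (by simp [f, g]) (by simp [f, g])
      (h'.toBX.map_p_eq (F' := IBX D P Q ω x₀ y₀ ρ) hD (by simp [f, g]) (by simp [f, g]))
      (h'.map_q_eq (F' := IBX D P Q ω x₀ y₀ ρ) hP' hD (by simp [f, g])
        fun z => (congrArg g (hbar z)).trans (SurjIBX.lift_u _ z)))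

theorem equivSurjIBX_e (a : A) (a' : Aᵐᵒᵖ) :
    equivSurjIBX hD hP hQ hP' hQ' (IBX.e D P Q ω x₀ y₀ ρ (a ⊗ₜ a')) =
      SurjIBX.s D P Q b x y c a * SurjIBX.t D P Q b x y c a' :=
  IBX.lift_e _ a a'

theorem equivSurjIBX_v (z : X) :
    equivSurjIBX hD hP hQ hP' hQ' (IBX.v D P Q ω x₀ y₀ ρ z) = SurjIBX.v D P Q b x y c z :=
  IBX.lift_v _ z

theorem equivSurjIBX_p (z : X) (a a' : A) :
    equivSurjIBX hD hP hQ hP' hQ' (IBX.p D P Q ω x₀ y₀ ρ (z ⊗ₜ (a • D.d a'))) =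
      ⁅SurjIBX.v D P Q b x y c z, SurjIBX.t D P Q b x y c (op a')⁆ *
        SurjIBX.t D P Q b x y c (op a) :=
  (IBX.lift_p _ _).trans (SurjIBX.relations.toSurjBX.p_tmul_smul_d hD z a a')

theorem equivSurjIBX_q (a a' : A) (z : Y) :
    equivSurjIBX hD hP hQ hP' hQ' (IBX.q D P Q ω x₀ y₀ ρ ((a • D.d a') ⊗ₜ z)) =
      SurjIBX.s D P Q b x y c a * ⁅SurjIBX.u D P Q b x y c z, SurjIBX.s D P Q b x y c a'⁆ :=
  (IBX.lift_q _ _).trans (SurjIBX.relations.q_smul_d_tmul hD a a' z)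

theorem equivSurjIBX_symm_u (z : Y) :
    (equivSurjIBX hD hP hQ hP' hQ').symm (SurjIBX.u D P Q b x y c z) =
      ∑ i, IBX.q D P Q ω x₀ y₀ ρ (D.d (b i) ⊗ₜ z) * IBX.v D P Q ω x₀ y₀ ρ (x i) :=
  (SurjIBX.lift_u _ z).trans (bar_apply _ _ _ _ z)

end IBX

end ComparisonIBX

end

end SurjCalc

theorem mainTheorem10 {K A Ω X Y : Type*} [Field K] [Ring A] [Algebra K A]
    [AddCommGroup Ω] [Module K Ω] [Module A Ω] [Module Aᵐᵒᵖ Ω]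
    [IsScalarTower K A Ω] [IsScalarTower K Aᵐᵒᵖ Ω]
    [SMulCommClass A Aᵐᵒᵖ Ω]
    [AddCommGroup X] [Module K X] [Module A X] [Module Aᵐᵒᵖ X]
    [IsScalarTower K A X] [IsScalarTower K Aᵐᵒᵖ X] [SMulCommClass A Aᵐᵒᵖ X]
    [AddCommGroup Y] [Module K Y] [Module A Y] [Module Aᵐᵒᵖ Y]
    [IsScalarTower K A Y] [IsScalarTower K Aᵐᵒᵖ Y] [SMulCommClass A Aᵐᵒᵖ Y]
    (D : SurjCalc.Calculus K A Ω) (hD : D.IsSurjective)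
    (P : SurjCalc.LeftPairing K A Ω X) (Q : SurjCalc.RightPairing K A Ω Y)
    {n m : ℕ} (ω : Fin n → Ω) (x : Fin n → X) (hP : P.IsCoev ω x)
    (y : Fin m → Y) (ρ : Fin m → Ω) (hQ : Q.IsCoev y ρ) :
    (∃ (k : ℕ) (b : Fin k → A) (x' : Fin k → X), P.IsCoev (fun i => D.d (b i)) x') ∧
    (∃ (l : ℕ) (y' : Fin l → Y) (c : Fin l → A), Q.IsCoev y' (fun j => D.d (c j))) ∧
    (∃ β : SurjCalc.BX D P ≃ₐ[K] SurjCalc.SurjBX D P,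
      (∀ a a' : A, β (SurjCalc.BX.e D P (a ⊗ₜ op a')) =
        SurjCalc.SurjBX.s D P a * SurjCalc.SurjBX.t D P (op a')) ∧
      (∀ z : X, β (SurjCalc.BX.v D P z) = SurjCalc.SurjBX.v D P z) ∧
      (∀ (z : X) (a b : A), β (SurjCalc.BX.p D P (z ⊗ₜ (a • D.d b))) =
        (SurjCalc.SurjBX.v D P z * SurjCalc.SurjBX.t D P (op b) -
          SurjCalc.SurjBX.t D P (op b) * SurjCalc.SurjBX.v D P z) *
            SurjCalc.SurjBX.t D P (op a))) ∧
    ∀ {k l : ℕ} (b : Fin k → A) (x' : Fin k → X) (y' : Fin l → Y) (c : Fin l → A),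
      P.IsCoev (fun i => D.d (b i)) x' → Q.IsCoev y' (fun j => D.d (c j)) →
      ∃ κ : SurjCalc.IBX D P Q ω x y ρ ≃ₐ[K] SurjCalc.SurjIBX D P Q b x' y' c,
        (∀ a a' : A, κ (SurjCalc.IBX.e D P Q ω x y ρ (a ⊗ₜ op a')) =
          SurjCalc.SurjIBX.s D P Q b x' y' c a *
            SurjCalc.SurjIBX.t D P Q b x' y' c (op a')) ∧
        (∀ z : X, κ (SurjCalc.IBX.v D P Q ω x y ρ z) = SurjCalc.SurjIBX.v D P Q b x' y' c z) ∧
        (∀ (z : X) (a a' : A), κ (SurjCalc.IBX.p D P Q ω x y ρ (z ⊗ₜ (a • D.d a'))) =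
          (SurjCalc.SurjIBX.v D P Q b x' y' c z * SurjCalc.SurjIBX.t D P Q b x' y' c (op a') -
            SurjCalc.SurjIBX.t D P Q b x' y' c (op a') * SurjCalc.SurjIBX.v D P Q b x' y' c z) *
              SurjCalc.SurjIBX.t D P Q b x' y' c (op a)) ∧
        (∀ (a a' : A) (z : Y), κ (SurjCalc.IBX.q D P Q ω x y ρ ((a • D.d a') ⊗ₜ z)) =
          SurjCalc.SurjIBX.s D P Q b x' y' c a *
            (SurjCalc.SurjIBX.u D P Q b x' y' c z * SurjCalc.SurjIBX.s D P Q b x' y' c a' -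
              SurjCalc.SurjIBX.s D P Q b x' y' c a' * SurjCalc.SurjIBX.u D P Q b x' y' c z)) ∧
        (∀ z : Y, κ.symm (SurjCalc.SurjIBX.u D P Q b x' y' c z) =
          ∑ i, SurjCalc.IBX.q D P Q ω x y ρ (D.d (b i) ⊗ₜ z) *
            SurjCalc.IBX.v D P Q ω x y ρ (x' i)) :=
  ⟨hP.exists_d hD, hQ.exists_d hD,
    ⟨SurjCalc.BX.equivSurjBX P hD,
      fun a a' => SurjCalc.BX.equivSurjBX_e P hD a (op a'),
      SurjCalc.BX.equivSurjBX_v P hD,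
      SurjCalc.BX.equivSurjBX_p P hD⟩,
    fun _ _ _ _ hP' hQ' =>
    ⟨SurjCalc.IBX.equivSurjIBX hD hP hQ hP' hQ',
      fun a a' => SurjCalc.IBX.equivSurjIBX_e hD hP hQ hP' hQ' a (op a'),
      SurjCalc.IBX.equivSurjIBX_v hD hP hQ hP' hQ',
      SurjCalc.IBX.equivSurjIBX_p hD hP hQ hP' hQ',
      SurjCalc.IBX.equivSurjIBX_q hD hP hQ hP' hQ',
      SurjCalc.IBX.equivSurjIBX_symm_u hD hP hQ hP' hQ'⟩⟩
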